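/- \textbf{Theorem.} Let $c\ge 0$ be an integer and $\varepsilon>0$ a real number. There is a constant $C=C(c,\varepsilon)$ such that the following holds for every $n\ge 0$. Let $g:\{0,1\}^n\to\{0,1\}$ be computed by a formula $F$ whose gates are AND, OR, XOR and Majority gates of arbitrary fan-in ($\ge 1$) and whose leaves are variables, negated variables or Boolean constants, where $\mathrm{MAJ}(z_1,\dots,z_m)=1$ iff $\sum_i z_i\ge m/2$. Suppose that $F$ has size (number of leaves) $s$ and that every path from the root to a leaf of $F$ contains at most $c$ Majority gates. Then for every partition of the $n$ input bits between Alice and Bob, the garden-hose complexity of the resulting two-party function satisfies $$GH(g)\le C\cdot s^{1+\varepsilon}.$$ Here a garden-hose protocol with $p$ pipes for $f:\mathcal X\times\mathcal Y\to\{0,1\}$ consists of a vertex set $V$ of $p$ pipes, an additional vertex $t\notin V$ (the tap), a map sending every $x\in\mathcal X$ to a matching $E_A(x)$ on $V\cup\{t\}$, and a map sending every $y\in\mathcal Y$ to a matching $E_B(y)$ on $V$ (matchings need not be perfect). It computes $f$ if for all $x,y$ the unique maximal path starting at $t$, following alternately edges of $E_A(x)$ and $E_B(y)$, has odd length when $f(x,y)=1$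 and even length when $f(x,y)=0$. $GH(f)$ is the smallest $p$ for which such a protocol exists. -/

import Mathlib

/-! ### Boolean formulae with AND, OR, XOR and Majority gates of arbitrary fan-in -/

/-- The four kinds of gates. -/
inductive GateKind where
  | and
  | or
  | xor
  | maj
  deriving DecidableEq

/-- The Boolean function computed by a gate of fan-in `m`. The Majority gate outputs `1`
iff the number of ones among its `m` inputs is at least `m / 2`. -/
def GateKind.eval (k : GateKind) {m : ℕ} (v : Fin m → Bool) : Bool :=
  match k with
  | .and => decide (∀ i, v i = true)
  | .or => decide (∃ i, v i = true)
  | .xor => decide (Odd (Finset.univ.filter fun i => v i = true).card)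
  | .maj => decide (m ≤ 2 * (Finset.univ.filter fun i => v i = true).card)

/-- Boolean formulae on the variables `x_0, …, x_{n-1}`. The leaves are variables, negated
variables and Boolean constants; a gate may have any fan-in `m + 1 ≥ 1`. -/
inductive GateFormula (n : ℕ) where
  | var (i : Fin n) : GateFormula n
  | negVar (i : Fin n) : GateFormula n
  | const (b : Bool) : GateFormula n
  | gate (k : GateKind) (m : ℕ) (child : Fin (m + 1) → GateFormula n) : GateFormula n

namespace GateFormula

/-- The value of a formula on an assignment. -/
def eval {n : ℕ} (z : Fin n → Bool) : GateFormula n → Bool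
  | .var i => z i
  | .negVar i => !z i
  | .const b => b
  | .gate k _ child => k.eval fun i => (child i).eval z

/-- The size of a formula is its number of leaves. -/
def size {n : ℕ} : GateFormula n → ℕ
  | .var _ => 1
  | .negVar _ => 1
  | .const _ => 1
  | .gate _ _ child => ∑ i, (child i).size

/-- The maximal number of Majority gates on a path from the root to a leaf. -/
def majDepth {n : ℕ} : GateFormula n → ℕ
  | .var _ => 0
  | .negVar _ => 0
  | .const _ => 0
  | .gate k _ child =>
      (if k = GateKind.maj then 1 else 0) + Finset.univ.sup fun i => (child i).majDepth

/-- The formula `F` computes the Boolean function `g`. -/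
def Computes {n : ℕ} (F : GateFormula n) (g : (Fin n → Bool) → Bool) : Prop :=
  ∀ z, F.eval z = g z

end GateFormula

/-! ### The garden-hose model -/

/-- A garden-hose protocol with `s` pipes for players with input sets `X` and `Y`.
The vertices are the `s` pipes `some p` and the tap `none`. A matching is given by the
involution that sends every matched vertex to its partner and fixes the unmatched vertices.
Alice chooses a matching of the pipes and the tap, Bob chooses a matching of the pipes. -/
structure GardenHoseProtocol (X Y : Type*) (s : ℕ) where
  alice : X → Option (Fin s) → Option (Fin s)
  alice_involutive : ∀ x, Function.Involutive (alice x)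
  bob : Y → Fin s → Fin s
  bob_involutive : ∀ y, Function.Involutive (bob y)

namespace GardenHoseProtocol

variable {X Y : Type*} {s : ℕ}

/-- The vertex reached from the tap after `k` steps along the edges of Alice and Bob, which
alternate, starting with Alice. When there is no edge to follow, one stays in place. -/
def flow (P : GardenHoseProtocol X Y s) (x : X) (y : Y) : ℕ → Option (Fin s)
  | 0 => none
  | k + 1 =>
      if Even k then P.alice x (P.flow x y k) else Option.map (P.bob y) (P.flow x y k)

/-- The path that starts at the tap has exactly `k` edges: `k` edges can be followed, and
the vertex reached then has no further edge. -/
def HasPathLength (P : GardenHoseProtocol X Y s) (x : X) (y : Y) (k : ℕ) : Prop :=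
  (∀ j < k, P.flow x y (j + 1) ≠ P.flow x y j) ∧ P.flow x y (k + 1) = P.flow x y k

/-- The protocol computes `f`: on every input the parity of the length of the path from the
tap is the value of `f` (odd length for `1`, even length for `0`). -/
def Computes (P : GardenHoseProtocol X Y s) (f : X → Y → Bool) : Prop :=
  ∀ x y, ∃ k, P.HasPathLength x y k ∧ (Odd k ↔ f x y = true)

end GardenHoseProtocol

/-- The garden-hose complexity of `f`: the smallest number of pipes of a garden-hose protocol
that computes `f` (and `⊤` if there is none). -/
noncomputable def gardenHoseComplexity {X Y : Type*} (f : X → Y → Bool) : ℕ∞ :=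
  ⨅ (s : ℕ) (_ : ∃ P : GardenHoseProtocol X Y s, P.Computes f), (s : ℕ∞)

/-- The two-party function obtained from `g` when Alice holds the input bits with index
in `A` and Bob holds all the others. -/
def splitInput {n : ℕ} (g : (Fin n → Bool) → Bool) (A : Finset (Fin n)) :
    ({i // i ∈ A} → Bool) → ({i // i ∉ A} → Bool) → Bool :=
  fun x y => g fun i => if h : i ∈ A then x ⟨i, h⟩ else y ⟨i, h⟩

/-! For every `h`, two operations on at most `s` functions cost only a factor `O(s ^ (1 / h))` over
the total cost of their inputs: a binary formula over AND, OR and XOR (`exists_treeFactor`), and one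
Majority gate (`exists_majorityFactor`). Alternating them through `c` nested Majority gates
(`gHle_of_majDepth_le`) costs `s ^ O(c / h)` times the number of leaves, and `h` is chosen large
compared with `c / ε`.

Both rest on reversibility. Matchings are symmetric, so a protocol can be run to its dead end and
back; this lets a function switch a permutation of wires on or off (`Realizable.control`). Such
networks compose with additive cost, can be inverted, and are turned back into protocols by
`Realizable.readout`.

For formulae the wires are the vectors of `F_2 ^ r`. Branching programs over `F_2` become linear
permutations: sums are parallel, products are series, and a commutator removes the garbage left in
the inner nodes (`IsNet.commutator`). A formula of size `K * q` splits into pieces of size at most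
`q`, with `O(K)` inner nodes and a total weight that grows by a constant factor independent of `K`
(`BTree.exists_netCost`). Hence multiplying the size by `K` multiplies the cost only by `48`, and `K
= 48 ^ h` gives the exponent `1 / h`.

For Majority the count is never stored in full. With `2 * h` coprime moduli of order `s ^ (1 / (2 *
h))`, the sign of `d = 2 * count - m` is read from a rounded Chinese remainder sum. If rounding
leaves the sign open, `d` is so small that one modulus fewer suffices (`sign_test`,
`exists_majority_tree`). -/

namespace GardenHose

open Relation

/-! ### Alternating paths -/

section Paths

variable {V V' : Type*}

/-- The move of Alice (`true`) or Bob (`false`). -/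
def move (α β : V → V) : Bool → V → V
  | true => α
  | false => β

/-- A step of an alternating path; the second component says whether Alice moves next. -/
inductive Step (α β : V → V) : V × Bool → V × Bool → Prop
  | mk (v : V) (b : Bool) (h : move α β b v ≠ v) : Step α β (v, b) (move α β b v, !b)

/-- The existence of an alternating path all of whose steps follow an edge. -/
abbrev Path (α β : V → V) : V × Bool → V × Bool → Prop := ReflTransGen (Step α β)

theorem Step.alice {α β : V → V} {v w : V} (h : α v = w) (hw : w ≠ v) :
    Step α β (v, true) (w, false) := by
  subst h; exact Step.mk v true hw

theorem Step.bob {α β : V → V} {v w : V} (h : β v = w) (hw : w ≠ v) :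
    Step α β (v, false) (w, true) := by
  subst h; exact Step.mk v false hw

theorem move_involutive {α β : V → V} (hα : Function.Involutive α)
    (hβ : Function.Involutive β) (b : Bool) : Function.Involutive (move α β b) := by
  cases b <;> assumption

theorem Step.reverse {α β : V → V} (hα : Function.Involutive α) (hβ : Function.Involutive β)
    {p q : V × Bool} (h : Step α β p q) : Step α β (q.1, !q.2) (p.1, !p.2) := by
  obtain ⟨v, b, h⟩ := h
  have hi := move_involutive hα hβ b v
  have := Step.mk (α := α) (β := β) (move α β b v) b (by rw [hi]; exact h.symm)
  rw [hi] at this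
  simpa using this

/-- Both players' edges are symmetric. The turn flips because the edge used last is used first on
the way back. -/
theorem Path.reverse {α β : V → V} (hα : Function.Involutive α) (hβ : Function.Involutive β)
    {p q : V × Bool} (h : Path α β p q) : Path α β (q.1, !q.2) (p.1, !p.2) := by
  induction h with
  | refl => exact .refl
  | tail _ hs ih => exact .head (hs.reverse hα hβ) ih

theorem Path.map {α β : V → V} {α' β' : V' → V'} (φ : V → V') (hφ : Function.Injective φ)
    (hα : ∀ v, α v ≠ v → α' (φ v) = φ (α v)) (hβ : ∀ v, β v ≠ v → β' (φ v) = φ (β v))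
    {p q : V × Bool} (h : Path α β p q) : Path α' β' (φ p.1, p.2) (φ q.1, q.2) := by
  refine ReflTransGen.lift (p := Step α' β') (fun p : V × Bool => (φ p.1, p.2)) ?_ _ _ h
  rintro _ _ ⟨v, b, h⟩
  cases b
  · exact Step.bob (hβ v h) (hφ.ne h)
  · exact Step.alice (hα v h) (hφ.ne h)

end Paths

/-! ### Protocols and paths -/

section Protocols

variable {X Y : Type*}

/-- The function `f` has a garden-hose protocol with at most `p` pipes. -/
def GHle (f : X → Y → Bool) (p : ℕ) : Prop :=
  ∃ q ≤ p, ∃ P : GardenHoseProtocol X Y q, P.Computes f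

theorem GHle.mono {f : X → Y → Bool} {p q : ℕ} (h : GHle f p) (hpq : p ≤ q) : GHle f q := by
  obtain ⟨r, hr, h⟩ := h
  exact ⟨r, hr.trans hpq, h⟩

variable {s : ℕ} (P : GardenHoseProtocol X Y s) (x : X) (y : Y)

theorem flow_succ (k : ℕ) : P.flow x y (k + 1) =
    move (P.alice x) (Option.map (P.bob y)) (decide (Even k)) (P.flow x y k) := by
  rw [GardenHoseProtocol.flow]
  by_cases h : Even k <;> simp [h, move]

theorem map_bob_involutive : Function.Involutive (Option.map (P.bob y)) := by
  intro v
  cases v with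
  | none => rfl
  | some v => simp [P.bob_involutive y v]

theorem path_flow {k : ℕ} (h : ∀ j < k, P.flow x y (j + 1) ≠ P.flow x y j) :
    Path (P.alice x) (Option.map (P.bob y)) (none, true) (P.flow x y k, decide (Even k)) := by
  induction k with
  | zero => exact .refl
  | succ k ih =>
    refine (ih fun j hj => h j (by omega)).tail ?_
    have hk := h k (by omega)
    rw [flow_succ] at hk ⊢
    have hb : decide (Even (k + 1)) = !decide (Even k) := by
      by_cases hk : Even k <;> simp [hk, Nat.even_add_one]
    rw [hb]
    exact Step.mk _ _ hk

theorem exists_flow_of_path {p : Option (Fin s) × Bool}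
    (h : Path (P.alice x) (Option.map (P.bob y)) (none, true) p) :
    ∃ k, (∀ j < k, P.flow x y (j + 1) ≠ P.flow x y j) ∧ p = (P.flow x y k, decide (Even k)) := by
  induction h with
  | refl => exact ⟨0, by simp, by simp [GardenHoseProtocol.flow]⟩
  | tail _ hs ih =>
    obtain ⟨k, hk, rfl⟩ := ih
    obtain ⟨_, _, hs⟩ := hs
    refine ⟨k + 1, fun j hj => ?_, ?_⟩
    · rcases Nat.lt_succ_iff_lt_or_eq.1 hj with hj | rfl
      · exact hk j hj
      · rwa [flow_succ]
    · rw [flow_succ]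
      by_cases hk : Even k <;> simp [hk, Nat.even_add_one]

/-- A return to the tap after an odd number of edges would make the path a palindrome, and its
middle edge would then join a vertex to itself. -/
theorem flow_ne_none_of_odd {k : ℕ} (h : ∀ j < k, P.flow x y (j + 1) ≠ P.flow x y j)
    (hk : Odd k) : P.flow x y k ≠ none := by
  intro h0
  have hinv := fun b => move_involutive (P.alice_involutive x) (map_bob_involutive P y) b
  have key : ∀ i ≤ k, P.flow x y (k - i) = P.flow x y i := by
    intro i
    induction i with
    | zero => intro _; simpa [GardenHoseProtocol.flow] using h0
    | succ i ih =>
      intro hi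
      have h1 := ih (by omega)
      obtain ⟨l, hl⟩ : ∃ l, k - i = l + 1 := ⟨k - i - 1, by omega⟩
      have hl' : k - (i + 1) = l := by omega
      have hpar : decide (Even l) = decide (Even i) := by
        rcases hk with ⟨a, rfl⟩
        simp only [decide_eq_decide, Nat.even_iff]
        omega
      rw [hl', flow_succ, ← h1, hl, flow_succ, hpar, hinv]
  obtain ⟨a, rfl⟩ := hk
  refine h a (by omega) ?_
  rw [← key a (by omega)]
  congr 1
  omega

/-- On every input of a protocol for `f` there is a path from the tap to a dead end, and the
player who cannot continue is determined by the value of `f`. -/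
theorem exists_path_of_computes {f : X → Y → Bool} (hP : P.Computes f) :
    ∃ v, Path (P.alice x) (Option.map (P.bob y)) (none, true) (v, !f x y) ∧
      move (P.alice x) (Option.map (P.bob y)) (!f x y) v = v ∧ (f x y = true → v ≠ none) := by
  obtain ⟨k, ⟨h1, h2⟩, h3⟩ := hP x y
  have hb : (!f x y) = decide (Even k) := by
    by_cases hk : Odd k
    · rw [h3.1 hk]; simpa using hk
    · have : f x y = false := by simpa using mt h3.2 hk
      rw [this]; simpa using hk
  refine ⟨P.flow x y k, ?_, ?_, fun hf => flow_ne_none_of_odd P x y h1 (h3.2 hf)⟩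
  · rw [hb]; exact path_flow P x y h1
  · rw [hb, ← flow_succ, h2]

theorem computes_of_path {f : X → Y → Bool}
    (h : ∀ x y, ∃ v, Path (P.alice x) (Option.map (P.bob y)) (none, true) (v, !f x y) ∧
      move (P.alice x) (Option.map (P.bob y)) (!f x y) v = v) : P.Computes f := by
  intro x y
  obtain ⟨v, hp, hv⟩ := h x y
  obtain ⟨k, hk, he⟩ := exists_flow_of_path P x y hp
  obtain ⟨rfl, hb⟩ := Prod.mk.inj he
  refine ⟨k, ⟨hk, ?_⟩, ?_⟩
  · rw [flow_succ, ← hb, hv]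
  · rw [← Nat.not_even_iff_odd]
    cases hf : f x y <;> simp_all

/-- A pair of matchings on a finite vertex set with a tap that Bob leaves alone gives a
protocol. -/
theorem GHle.of_graph {V : Type*} [Fintype V] {f : X → Y → Bool} (t : V) (α : X → V → V)
    (β : Y → V → V) (hα : ∀ x, Function.Involutive (α x)) (hβ : ∀ y, Function.Involutive (β y))
    (ht : ∀ y, β y t = t)
    (h : ∀ x y, ∃ v, Path (α x) (β y) (t, true) (v, !f x y) ∧
      move (α x) (β y) (!f x y) v = v) : GHle f (Fintype.card V) := by
  classical
  let n := Fintype.card {a // a ≠ t}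
  let e : V ≃ Option (Fin n) :=
    (Equiv.optionSubtypeNe t).symm.trans (Equiv.optionCongr (Fintype.equivFin _))
  have het : e t = none := by simp [e]
  -- The default is never used: Bob's involution fixes the tap, so it maps no pipe there.
  let bob : Y → Fin n → Fin n := fun y v => (e (β y (e.symm (some v)))).getD v
  have hbob : ∀ y v, Option.map (bob y) v = e (β y (e.symm v)) := by
    intro y v
    cases v with
    | none =>
      have : e.symm none = t := by rw [Equiv.symm_apply_eq, het]
      simp [this, ht, het]
    | some v =>
      cases hw : e (β y (e.symm (some v))) with
      | none =>
        rw [← het, e.apply_eq_iff_eq] at hw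
        have := congrArg (β y) hw
        rw [hβ, ht, Equiv.symm_apply_eq, het] at this
        cases this
      | some w => simp [bob, hw]
  let P : GardenHoseProtocol X Y n :=
    { alice := fun x v => e (α x (e.symm v))
      alice_involutive := fun x v => by simp [hα x (e.symm v)]
      bob := bob
      bob_involutive := fun y v => by
        have h1 : Option.map (bob y) (Option.map (bob y) (some v)) = some v := by
          rw [hbob, hbob]; simp [hβ y (e.symm (some v))]
        simpa using h1 }
  refine ⟨n, Fintype.card_subtype_le _, P, computes_of_path P fun x y => ?_⟩
  obtain ⟨v, hp, hv⟩ := h x y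
  refine ⟨e v, ?_, ?_⟩
  · have := hp.map (α' := P.alice x) (β' := Option.map (P.bob y)) e e.injective
      (fun v _ => by simp [P]) (fun v _ => by simp [P, hbob])
    simpa [het] using this
  · cases hf : f x y
    · rw [hf] at hv
      simpa [move, P] using hv
    · rw [hf] at hv
      change Option.map (bob y) (e v) = e v
      rw [hbob, e.symm_apply_apply]
      exact congrArg e hv

theorem GHle.of_alice (a : X → Bool) : GHle (fun x (_ : Y) => a x) 1 := by
  refine ⟨1, le_rfl, ⟨fun x v => if a x then v.elim (some 0) (fun _ => none) else v, ?_,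
    fun _ v => v, fun _ _ => rfl⟩, computes_of_path _ fun x y => ?_⟩
  · intro x v
    cases a x <;> rcases v with _ | v <;> simp
    exact Subsingleton.elim _ _
  · cases h : a x
    · exact ⟨none, .refl, by simp [move, h]⟩
    · exact ⟨some 0, .single (Step.alice (by simp [h]) (by simp)), by simp [move]⟩

/-- Alice always opens the first pipe; Bob adds a second edge exactly when his bit is `0`. -/
theorem GHle.of_bob (b : Y → Bool) : GHle (fun (_ : X) y => b y) 2 := by
  refine ⟨2, le_rfl, ⟨fun _ v => Equiv.swap none (some 0) v, ?_,
    fun y v => if b y then v else Equiv.swap 0 1 v, ?_⟩, computes_of_path _ fun x y => ?_⟩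
  · intro _ v; simp
  · intro y v; cases b y <;> simp
  · cases h : b y
    · refine ⟨some 1, .tail (.single (Step.alice (w := some 0) (by simp) (by simp)))
        (Step.bob (by simp [h]) (by simp)), ?_⟩
      simp only [move, Bool.not_false]
      exact Equiv.swap_apply_of_ne_of_ne (by simp) (by simp)
    · exact ⟨some 0, .single (Step.alice (by simp) (by simp)), by simp [move, h]⟩

theorem exists_gardenHoseComplexity_eq {f : X → Y → Bool} {p : ℕ} (h : GHle f p) :
    ∃ m : ℕ, gardenHoseComplexity f = m ∧ m ≤ p := by
  obtain ⟨q, hq, hP⟩ := h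
  have hle : gardenHoseComplexity f ≤ (q : ℕ∞) := iInf₂_le q hP
  obtain ⟨m, hm⟩ := ENat.ne_top_iff_exists.1 (ne_top_of_le_ne_top (ENat.natCast_ne_top q) hle)
  rw [← hm, Nat.cast_le] at hle
  exact ⟨m, hm.symm, hle.trans hq⟩

end Protocols

/-! ### Conditional permutations of wires -/

section Link

variable {S : Type}

/-- The involution of the terminals that connects `s` with `π s`. -/
def link (π : Equiv.Perm S) : S ⊕ S → S ⊕ S
  | .inl s => .inr (π s)
  | .inr s => .inl (π.symm s)

theorem link_involutive (π : Equiv.Perm S) : Function.Involutive (link π) := by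
  rintro (s | s) <;> simp [link]

end Link

section Realizable

variable {X Y S : Type} [Fintype S]

/-- The input-dependent permutation `σ` of the set `S` of wires is implemented by a network
of at most `c` pipes: the pipes are input terminals, output terminals, and inner pipes, Bob
leaves the terminals alone, and the path from the input `s` leads to the output `σ s`. -/
def Realizable (σ : X → Y → Equiv.Perm S) (c : ℕ) : Prop :=
  ∃ (W : Type) (_ : Fintype W) (α : X → (S ⊕ S) ⊕ W → (S ⊕ S) ⊕ W) (β : Y → W → W),
    (∀ x, Function.Involutive (α x)) ∧ (∀ y, Function.Involutive (β y)) ∧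
    Fintype.card W + 2 * Fintype.card S ≤ c ∧
    ∀ x y s, Path (α x) (Sum.map id (β y)) (.inl (.inl s), true) (.inl (.inr (σ x y s)), false)

namespace Realizable

theorem mono {σ : X → Y → Equiv.Perm S} {c d : ℕ} (h : Realizable σ c) (hcd : c ≤ d) :
    Realizable σ d := by
  obtain ⟨W, i, α, β, h1, h2, h3, h4⟩ := h
  exact ⟨W, i, α, β, h1, h2, h3.trans hcd, h4⟩

theorem const (π : Equiv.Perm S) :
    Realizable (fun (_ : X) (_ : Y) => π) (2 * Fintype.card S) := by
  refine ⟨Empty, inferInstance, fun _ => Sum.map (link π) id, fun _ => id, ?_, fun _ _ => rfl,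
    by simp, fun x y s => .single (Step.alice (by simp [link]) (by simp))⟩
  rintro _ (s | s)
  · simp [link_involutive π s]
  · rfl

/-- The same network run backwards, with input and output terminals exchanged. -/
theorem inv {σ : X → Y → Equiv.Perm S} {c : ℕ} (h : Realizable σ c) :
    Realizable (fun x y => (σ x y)⁻¹) c := by
  obtain ⟨W, i, α, β, h1, h2, h3, h4⟩ := h
  let e : (S ⊕ S) ⊕ W → (S ⊕ S) ⊕ W := Sum.map Sum.swap id
  have he : Function.Involutive e := by rintro ((s | s) | w) <;> rfl
  have hβ : ∀ y, Function.Involutive (Sum.map (id : S ⊕ S → S ⊕ S) (β y)) := by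
    rintro y (s | w)
    · rfl
    · simp [h2 y w]
  refine ⟨W, i, fun x v => e (α x (e v)), β, fun x v => ?_, h2, h3, fun x y s => ?_⟩
  · simp [he _, h1 x _]
  · have hp := (h4 x y ((σ x y)⁻¹ s)).reverse (h1 x) (hβ y)
    have := hp.map (α' := fun v => e (α x (e v))) (β' := Sum.map id (β y)) e he.injective
      (fun v _ => by simp [he v]) (fun v _ => by rcases v with (s | s) | w <;> rfl)
    simpa [e] using this

/-- Bob joins the outputs of the first network to the inputs of the second. These terminals become
inner pipes and are already paid for. -/
theorem mul {σ τ : X → Y → Equiv.Perm S} {c d : ℕ} (hτ : Realizable τ d)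
    (hσ : Realizable σ c) : Realizable (fun x y => τ x y * σ x y) (d + c) := by
  obtain ⟨W₁, i₁, α₁, β₁, h1, h2, h3, h4⟩ := hσ
  obtain ⟨W₂, i₂, α₂, β₂, k1, k2, k3, k4⟩ := hτ
  let E : ((S ⊕ S) ⊕ W₁) ⊕ ((S ⊕ S) ⊕ W₂) ≃ (S ⊕ S) ⊕ ((W₁ ⊕ W₂) ⊕ (S ⊕ S)) :=
    { toFun := fun
        | .inl (.inl (.inl s)) => .inl (.inl s)
        | .inl (.inl (.inr s)) => .inr (.inr (.inl s))
        | .inl (.inr w) => .inr (.inl (.inl w))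
        | .inr (.inl (.inl s)) => .inr (.inr (.inr s))
        | .inr (.inl (.inr s)) => .inl (.inr s)
        | .inr (.inr w) => .inr (.inl (.inr w))
      invFun := fun
        | .inl (.inl s) => .inl (.inl (.inl s))
        | .inr (.inr (.inl s)) => .inl (.inl (.inr s))
        | .inr (.inl (.inl w)) => .inl (.inr w)
        | .inr (.inr (.inr s)) => .inr (.inl (.inl s))
        | .inl (.inr s) => .inr (.inl (.inr s))
        | .inr (.inl (.inr w)) => .inr (.inr w)
      left_inv := by rintro (((s | s) | w) | ((s | s) | w)) <;> rfl
      right_inv := by rintro ((s | s) | ((w | w) | (s | s))) <;> rfl }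
  refine ⟨(W₁ ⊕ W₂) ⊕ (S ⊕ S), inferInstance, fun x v => E (Sum.map (α₁ x) (α₂ x) (E.symm v)),
    fun y => Sum.map (Sum.map (β₁ y) (β₂ y)) Sum.swap, fun x v => ?_, ?_, ?_, fun x y s => ?_⟩
  · obtain ⟨v, rfl⟩ := E.surjective v
    rcases v with v | v
    · simp [h1 x v]
    · simp [k1 x v]
  · rintro y ((w | w) | s)
    · simp [h2 y w]
    · simp [k2 y w]
    · simp
  · simp only [Fintype.card_sum]
    omega
  · have p₁ := (h4 x y s).map (α' := fun v => E (Sum.map (α₁ x) (α₂ x) (E.symm v)))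
      (β' := Sum.map id (Sum.map (Sum.map (β₁ y) (β₂ y)) Sum.swap)) (E ∘ Sum.inl)
      (E.injective.comp Sum.inl_injective) (fun v _ => by simp)
      (by rintro ((s | s) | w) h <;> first | rfl | exact absurd rfl h)
    have p₂ := (k4 x y (σ x y s)).map (α' := fun v => E (Sum.map (α₁ x) (α₂ x) (E.symm v)))
      (β' := Sum.map id (Sum.map (Sum.map (β₁ y) (β₂ y)) Sum.swap)) (E ∘ Sum.inr)
      (E.injective.comp Sum.inr_injective) (fun v _ => by simp)
      (by rintro ((s | s) | w) h <;> first | rfl | exact absurd rfl h)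
    refine (ReflTransGen.tail p₁ (Step.bob (w := .inr (.inr (.inr (σ x y s)))) rfl ?_)).trans p₂
    simp [E]

/-- A function with a garden-hose protocol can control a permutation: two copies of the
protocol for every wire are linked at their dead ends. -/
theorem control {f : X → Y → Bool} {p : ℕ} (hf : GHle f p) (π : Equiv.Perm S) :
    Realizable (fun x y => if f x y then π else 1) (2 * Fintype.card S * (p + 1)) := by
  classical
  obtain ⟨q, hq, P, hP⟩ := hf
  let E : (S ⊕ S) × Option (Fin q) ≃ (S ⊕ S) ⊕ ((S ⊕ S) × Fin q) :=
    { toFun := fun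
        | (t, none) => .inl t
        | (t, some v) => .inr (t, v)
      invFun := fun
        | .inl t => (t, none)
        | .inr (t, v) => (t, some v)
      left_inv := by rintro ⟨t, _ | v⟩ <;> rfl
      right_inv := by rintro (t | ⟨t, v⟩) <;> rfl }
  -- A path stuck at Alice's turn signals `0` and crosses to the output copy of the same wire; one
  -- stuck at Bob's turn signals `1` and crosses along `π`. It then retraces the protocol to the
  -- output terminal.
  let A : X → (S ⊕ S) × Option (Fin q) → (S ⊕ S) × Option (Fin q) := fun x v =>
    if P.alice x v.2 = v.2 then (link 1 v.1, v.2) else (v.1, P.alice x v.2)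
  let B : Y → (S ⊕ S) × Fin q → (S ⊕ S) × Fin q := fun y v =>
    if P.bob y v.2 = v.2 then (link π v.1, v.2) else (v.1, P.bob y v.2)
  have hA : ∀ x, Function.Involutive (A x) := by
    rintro x ⟨t, v⟩
    by_cases h : P.alice x v = v
    · simp [A, h, link_involutive _ t]
    · simp [A, h, P.alice_involutive x v, Ne.symm h]
  have hB : ∀ y, Function.Involutive (B y) := by
    rintro y ⟨t, v⟩
    by_cases h : P.bob y v = v
    · simp [B, h, link_involutive _ t]
    · simp [B, h, P.bob_involutive y v, Ne.symm h]
  refine ⟨(S ⊕ S) × Fin q, inferInstance, fun x v => E (A x (E.symm v)), B, fun x v => ?_, hB,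
    ?_, fun x y s => ?_⟩
  · simp [hA x _]
  · simp only [Fintype.card_prod, Fintype.card_sum, Fintype.card_fin]
    nlinarith
  · obtain ⟨v, hp, hv, hn⟩ := exists_path_of_computes P x y hP
    have lift : ∀ t p₁ p₂, Path (P.alice x) (Option.map (P.bob y)) p₁ p₂ →
        Path (fun v => E (A x (E.symm v))) (Sum.map id (B y)) (E (t, p₁.1), p₁.2)
          (E (t, p₂.1), p₂.2) := by
      intro t p₁ p₂ hp
      refine hp.map (fun v => E (t, v)) (fun a b h => by simpa using h) (fun v hv => ?_)
        (fun v hv => ?_)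
      · simp [A, hv]
      · rcases v with _ | v
        · exact absurd rfl hv
        · have hv' : P.bob y v ≠ v := by simpa using hv
          simp [E, B, hv']
    have q₁ := lift (.inl s) _ _ hp
    have q₂ := fun t => lift (.inr t) _ _
      (hp.reverse (P.alice_involutive x) (map_bob_involutive P y))
    refine ReflTransGen.trans q₁ (ReflTransGen.head ?_ (q₂ _))
    cases hfx : f x y
    · rw [hfx] at hv
      have hv' : P.alice x v = v := hv
      refine Step.alice ?_ ?_
      · simp [A, hv', link, hfx]
      · simp
    · rw [hfx] at hv
      have hv' : Option.map (P.bob y) v = v := hv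
      rcases v with _ | v
      -- Bob is never stuck at the tap, the one place where he has no crossing edge.
      · exact absurd rfl (hn hfx)
      · have hv'' : P.bob y v = v := by simpa using hv'
        refine Step.bob ?_ ?_
        · simp [E, B, hv'', link, hfx]
        · simp

/-- Reading off a function from the output wire of a conditional permutation. -/
theorem readout {σ : X → Y → Equiv.Perm S} {c : ℕ} (h : Realizable σ c) (s₀ : S)
    (acc : S → Bool) : GHle (fun x y => acc (σ x y s₀)) (c + Fintype.card S) := by
  obtain ⟨W, i, α, β, h1, h2, h3, h4⟩ := h
  -- At an output the path has odd length with Bob to move. Rejected outputs get one extra edge,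
  -- which makes the length even.
  let B : Y → ((S ⊕ S) ⊕ W) ⊕ S → ((S ⊕ S) ⊕ W) ⊕ S := fun y v => match v with
    | .inl (.inl (.inl s)) => .inl (.inl (.inl s))
    | .inl (.inl (.inr s)) => if acc s then .inl (.inl (.inr s)) else .inr s
    | .inl (.inr w) => .inl (.inr (β y w))
    | .inr s => if acc s then .inr s else .inl (.inl (.inr s))
  have hle : Fintype.card (((S ⊕ S) ⊕ W) ⊕ S) ≤ c + Fintype.card S := by
    simp only [Fintype.card_sum]
    omega
  refine GHle.mono (GHle.of_graph (V := ((S ⊕ S) ⊕ W) ⊕ S) (.inl (.inl (.inl s₀)))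
    (fun x => Sum.map (α x) id) B ?_ ?_ (fun _ => rfl) fun x y => ?_) hle
  · rintro x (v | s)
    · simp [h1 x v]
    · rfl
  · rintro y (((s | s) | w) | s)
    · rfl
    · cases hs : acc s <;> simp [B, hs]
    · simp [B, h2 y w]
    · cases hs : acc s <;> simp [B, hs]
  · have p := (h4 x y s₀).map (α' := Sum.map (α x) id) (β' := B y) Sum.inl Sum.inl_injective
      (fun v _ => rfl) (by rintro ((s | s) | w) h <;> first | rfl | exact absurd rfl h)
    cases hs : acc (σ x y s₀)
    · refine ⟨.inr (σ x y s₀), ReflTransGen.tail p (Step.bob (by simp [B, hs]) (by simp)), rfl⟩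
    · exact ⟨_, p, by simp [B, hs, move]⟩

end Realizable

end Realizable

/-! ### Linear maps over the field with two elements -/

section Linear

variable {ι : Type}

/-- The permutation `U` acts as an algebraic branching program with source `j`, sink `i` and
inner nodes `I` that computes `a`. -/
structure IsNet (U : Equiv.Perm (ι → ZMod 2)) (i j : ι) (I : Finset ι) (a : ZMod 2) : Prop where
  map_add : ∀ v w, U (v + w) = U v + U w
  apply_of_notMem : ∀ v, ∀ w ∉ I, w ≠ i → U v w = v w
  apply_eq_self : ∀ v, (∀ w ∈ I, v w = 0) → v j = 0 → U v = v
  apply_target : ∀ v, (∀ w ∈ I, v w = 0) → U v i = v i + a * v j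

theorem IsNet.mono {U : Equiv.Perm (ι → ZMod 2)} {i j : ι} {I J : Finset ι} {a : ZMod 2}
    (h : IsNet U i j I a) (hIJ : I ⊆ J) : IsNet U i j J a where
  map_add := h.map_add
  apply_of_notMem v w hw hi := h.apply_of_notMem v w (fun hI => hw (hIJ hI)) hi
  apply_eq_self v hv hj := h.apply_eq_self v (fun w hw => hv w (hIJ hw)) hj
  apply_target v hv := h.apply_target v fun w hw => hv w (hIJ hw)

variable [DecidableEq ι]

/-- The elementary map that adds `a` times the coordinate `j` to the coordinate `i`. -/
def shear (i j : ι) (h : i ≠ j) (a : ZMod 2) : Equiv.Perm (ι → ZMod 2) :=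
  Function.Involutive.toPerm (fun v => v + Pi.single i (a * v j)) fun v => by
    simp [h.symm, add_assoc, ← Pi.single_add, CharTwo.add_self_eq_zero]

theorem shear_apply (i j : ι) (h : i ≠ j) (a : ZMod 2) (v : ι → ZMod 2) :
    shear i j h a v = v + Pi.single i (a * v j) := rfl

theorem shear_zero (i j : ι) (h : i ≠ j) : shear i j h 0 = 1 := by
  ext v; simp [shear_apply]

theorem isNet_shear {i j : ι} (h : i ≠ j) (a : ZMod 2) : IsNet (shear i j h a) i j ∅ a where
  map_add v w := by
    simp only [shear_apply, Pi.add_apply, mul_add, Pi.single_add]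
    abel
  apply_of_notMem v w _ hi := by simp [shear_apply, hi]
  apply_eq_self v _ hj := by simp [shear_apply, hj]
  apply_target v _ := by simp [shear_apply]

/-- `U₁` may leave garbage in `I₁`, but it touches neither `I₂` nor the source, so `U₂` still starts
from zero inner nodes and the original `v j`. -/
theorem IsNet.parallel {U₁ U₂ : Equiv.Perm (ι → ZMod 2)} {i j : ι} {I₁ I₂ : Finset ι}
    {a₁ a₂ : ZMod 2} (h₁ : IsNet U₁ i j I₁ a₁) (h₂ : IsNet U₂ i j I₂ a₂)
    (hd : Disjoint I₁ I₂) (hi : i ∉ I₁ ∪ I₂) (hj : j ∉ I₁ ∪ I₂) (hij : i ≠ j) :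
    IsNet (U₂ * U₁) i j (I₁ ∪ I₂) (a₁ + a₂) where
  map_add v w := by simp [h₁.map_add, h₂.map_add]
  apply_of_notMem v w hw hwi := by
    simp only [Finset.mem_union, not_or] at hw
    simp [h₁.apply_of_notMem v w hw.1 hwi, h₂.apply_of_notMem _ w hw.2 hwi]
  apply_eq_self v hv hvj := by
    simp only [Finset.mem_union] at hv
    rw [Equiv.Perm.mul_apply, h₁.apply_eq_self v (fun w hw => hv w (.inl hw)) hvj,
      h₂.apply_eq_self v (fun w hw => hv w (.inr hw)) hvj]
  apply_target v hv := by
    simp only [Finset.mem_union, not_or] at hv hi hj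
    rw [Equiv.Perm.mul_apply, h₂.apply_target _ fun w hw => ?_,
      h₁.apply_target v fun w hw => hv w (.inl hw), h₁.apply_of_notMem v j hj.1 hij.symm]
    · ring
    · rw [h₁.apply_of_notMem v w (Finset.disjoint_right.1 hd hw) (fun e => hi.2 (e ▸ hw))]
      exact hv w (.inr hw)

/-- `U₂` puts `a₂ * v j` into the empty node `m`, which then serves as the source of `U₁`; the nodes
of `I₁` are still zero at that time. -/
theorem IsNet.series {U₁ U₂ : Equiv.Perm (ι → ZMod 2)} {i m j : ι} {I₁ I₂ : Finset ι}
    {a₁ a₂ : ZMod 2} (h₁ : IsNet U₁ i m I₁ a₁) (h₂ : IsNet U₂ m j I₂ a₂)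
    (hd : Disjoint I₁ I₂) (hi : i ∉ insert m (I₁ ∪ I₂))
    (hm : m ∉ I₁ ∪ I₂) :
    IsNet (U₁ * U₂) i j (insert m (I₁ ∪ I₂)) (a₁ * a₂) where
  map_add v w := by simp [h₁.map_add, h₂.map_add]
  apply_of_notMem v w hw hwi := by
    simp only [Finset.mem_insert, Finset.mem_union, not_or] at hw
    simp [h₁.apply_of_notMem _ w hw.2.1 hwi, h₂.apply_of_notMem _ w hw.2.2 hw.1]
  apply_eq_self v hv hvj := by
    simp only [Finset.mem_insert, Finset.mem_union] at hv
    rw [Equiv.Perm.mul_apply, h₂.apply_eq_self v (fun w hw => hv w (.inr (.inr hw))) hvj,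
      h₁.apply_eq_self v (fun w hw => hv w (.inr (.inl hw))) (hv m (.inl rfl))]
  apply_target v hv := by
    simp only [Finset.mem_insert, Finset.mem_union, not_or] at hv hi hm
    rw [Equiv.Perm.mul_apply, h₁.apply_target _ fun w hw => ?_,
      h₂.apply_target v fun w hw => hv w (.inr (.inr hw)), h₂.apply_of_notMem v i hi.2.2 hi.1,
      hv m (.inl rfl)]
    · ring
    · rw [h₂.apply_of_notMem v w (Finset.disjoint_left.1 hd hw) (fun e => hm.1 (e ▸ hw))]
      exact hv w (.inr (.inl hw))

/-- The value computed by a net is isolated by a commutator. -/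
theorem IsNet.commutator {U : Equiv.Perm (ι → ZMod 2)} {i j i' j' : ι} {I : Finset ι}
    {a : ZMod 2} (h : IsNet U i j I a) (hi : i' ≠ i) (hj : j ≠ j') (hij : i' ≠ j')
    (hi'j : i' ≠ j) (hij' : i ≠ j') (hne : i ≠ j) (hj'I : j' ∉ I) (hjI : j ∉ I) :
    shear i' i hi 1 * (U * shear j j' hj 1 * U⁻¹ * shear j j' hj 1) *
      (shear i' i hi 1 * (U * shear j j' hj 1 * U⁻¹ * shear j j' hj 1)) = shear i' j' hij a := by
  -- `D` adds the response `g` of the net to the input `v j'`: the entry `a * v j'` at `i`, and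
  -- garbage on `I`. The first shear copies `v i + a * v j'` into `i'`, the second `D` cancels the
  -- response, and the last shear removes `v i` again.
  set D := U * shear j j' hj 1 * U⁻¹ * shear j j' hj 1 with hD
  let g : ZMod 2 → ι → ZMod 2 := fun c => U (Pi.single j c) + Pi.single j c
  have hself : ∀ w : ι → ZMod 2, w + w = 0 := fun w => by
    ext; simp [CharTwo.add_self_eq_zero]
  have hDv : ∀ v, D v = v + g (v j') := by
    intro v
    have h1 : (U⁻¹ (shear j j' hj 1 v)) j' = v j' := by
      have := h.apply_of_notMem (U⁻¹ (shear j j' hj 1 v)) j' hj'I hij'.symm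
      rw [Equiv.Perm.inv_def, Equiv.apply_symm_apply] at this
      rw [Equiv.Perm.inv_def]
      rw [← this]; simp [shear_apply, hj.symm]
    rw [hD, Equiv.Perm.mul_apply, Equiv.Perm.mul_apply, Equiv.Perm.mul_apply, shear_apply _ _ _ _
      (U⁻¹ _), h.map_add, Equiv.Perm.inv_def, Equiv.apply_symm_apply, ← Equiv.Perm.inv_def, h1, one_mul, shear_apply, one_mul]
    simp only [g]
    abel
  have hgv : ∀ c, ∀ w ∉ I, w ≠ i → g c w = 0 := by
    intro c w hw hwi
    have := h.apply_of_notMem (Pi.single j c) w hw hwi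
    simp only [g, Pi.add_apply, this, CharTwo.add_self_eq_zero]
  have hgi : ∀ c, g c i = a * c := by
    intro c
    have := h.apply_target (Pi.single j c) fun w hw => by
      rw [Pi.single_eq_of_ne]; rintro rfl; exact hjI hw
    simp only [g, Pi.add_apply, this]
    simp [hne]
  ext1 v
  change shear i' i hi 1 (D (shear i' i hi 1 (D v))) = _
  rw [hDv v,
    shear_apply _ _ _ _ (v + _), hDv, shear_apply, shear_apply]
  have e1 : (v + g (v j')) i = v i + a * v j' := by rw [Pi.add_apply, hgi]
  have e2 : (v + g (v j') + (Pi.single i' (1 * (v + g (v j')) i) : ι → ZMod 2)) j' = v j' := by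
    simp [hgv _ j' hj'I hij'.symm, hij.symm]
  rw [e2]
  have e3 : (v + g (v j') + (Pi.single i' (1 * (v + g (v j')) i) : ι → ZMod 2) + g (v j')) i =
      v i := by
    simp only [Pi.add_apply, Pi.single_eq_of_ne hi.symm, hgi, add_zero]
    rw [add_assoc, CharTwo.add_self_eq_zero, add_zero]
  rw [e3, e1, one_mul, one_mul, Pi.single_add]
  calc _ = v + Pi.single i' (a * v j') + (g (v j') + g (v j')) +
        ((Pi.single i' (v i) : ι → ZMod 2) + Pi.single i' (v i)) := by abel
    _ = _ := by rw [hself, hself, add_zero, add_zero]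

end Linear

/-! ### Costs of nets -/

section Cost

variable {X Y : Type}

/-- A Boolean function as a function to the field with two elements. -/
def bit (f : X → Y → Bool) (x : X) (y : Y) : ZMod 2 := if f x y then 1 else 0

/-- All elementary maps on `r` coordinates controlled by `f` can be implemented at cost `c`. -/
def ShearCost (r : ℕ) (f : X → Y → ZMod 2) (c : ℕ) : Prop :=
  ∀ (i j : Fin r) (h : i ≠ j), Realizable (fun x y => shear i j h (f x y)) c

/-- The function `f` has nets with `k` inner nodes of cost `c`. -/
def NetCost (r k : ℕ) (f : X → Y → ZMod 2) (c : ℕ) : Prop :=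
  ∀ (i j : Fin r) (I : Finset (Fin r)), i ≠ j → i ∉ I → j ∉ I → k ≤ I.card →
    ∃ U : X → Y → Equiv.Perm (Fin r → ZMod 2), Realizable U c ∧
      ∀ x y, IsNet (U x y) i j I (f x y)

variable {r k k₁ k₂ c c₁ c₂ : ℕ} {f f₁ f₂ : X → Y → ZMod 2}

theorem NetCost.mono {g : X → Y → ZMod 2} (h : NetCost r k f c) {d l : ℕ} (hk : k ≤ l)
    (hd : c ≤ d) (hf : ∀ x y, g x y = f x y) : NetCost r l g d := by
  intro i j I h1 h2 h3 h4
  obtain ⟨U, hU, h⟩ := h i j I h1 h2 h3 (hk.trans h4)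
  exact ⟨U, hU.mono hd, fun x y => by rw [hf]; exact h x y⟩

theorem ShearCost.netCost (h : ShearCost r f c) : NetCost r 0 f c := by
  intro i j I hij _ _ _
  exact ⟨_, h i j hij, fun x y => (isNet_shear hij _).mono (Finset.empty_subset I)⟩

theorem NetCost.add (h₁ : NetCost r k₁ f₁ c₁) (h₂ : NetCost r k₂ f₂ c₂) :
    NetCost r (k₁ + k₂) (fun x y => f₁ x y + f₂ x y) (c₁ + c₂) := by
  intro i j I hij hi hj hk
  obtain ⟨I₁, hI₁, hc₁⟩ := Finset.exists_subset_card_eq (show k₁ ≤ I.card by omega)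
  have hI : I₁ ∪ (I \ I₁) = I := Finset.union_sdiff_of_subset hI₁
  have hc₂ : k₂ ≤ (I \ I₁).card := by rw [Finset.card_sdiff_of_subset hI₁]; omega
  obtain ⟨U₁, r₁, n₁⟩ := h₁ i j I₁ hij (fun h => hi (hI₁ h)) (fun h => hj (hI₁ h)) hc₁.ge
  obtain ⟨U₂, r₂, n₂⟩ := h₂ i j (I \ I₁) hij (fun h => hi (Finset.mem_sdiff.1 h).1)
    (fun h => hj (Finset.mem_sdiff.1 h).1) hc₂
  refine ⟨fun x y => U₂ x y * U₁ x y, (r₂.mul r₁).mono (by omega), fun x y => ?_⟩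
  have := (n₁ x y).parallel (n₂ x y) Finset.disjoint_sdiff (by rwa [hI]) (by rwa [hI]) hij
  rwa [hI] at this

theorem NetCost.mul (h₁ : NetCost r k₁ f₁ c₁) (h₂ : NetCost r k₂ f₂ c₂) :
    NetCost r (k₁ + k₂ + 1) (fun x y => f₁ x y * f₂ x y) (c₁ + c₂) := by
  intro i j I hij hi hj hk
  obtain ⟨m, hm⟩ := Finset.card_pos.1 (show 0 < I.card by omega)
  have hJ : (I.erase m).card = I.card - 1 := Finset.card_erase_of_mem hm
  obtain ⟨I₁, hI₁, hc₁⟩ := Finset.exists_subset_card_eq (show k₁ ≤ (I.erase m).card by omega)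
  have hu : I₁ ∪ (I.erase m \ I₁) = I.erase m := Finset.union_sdiff_of_subset hI₁
  have hI : insert m (I₁ ∪ (I.erase m \ I₁)) = I := by rw [hu, Finset.insert_erase hm]
  have hc₂ : k₂ ≤ (I.erase m \ I₁).card := by rw [Finset.card_sdiff_of_subset hI₁]; omega
  have hmi : i ≠ m := fun h => hi (h ▸ hm)
  have hmj : m ≠ j := fun h => hj (h ▸ hm)
  have hm₁ : m ∉ I₁ := fun h => Finset.notMem_erase m I (hI₁ h)
  have hm₂ : m ∉ I.erase m \ I₁ := fun h => Finset.notMem_erase m I (Finset.mem_sdiff.1 h).1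
  obtain ⟨U₁, r₁, n₁⟩ := h₁ i m I₁ hmi (fun h => hi (Finset.mem_of_mem_erase (hI₁ h))) hm₁ hc₁.ge
  obtain ⟨U₂, r₂, n₂⟩ := h₂ m j (I.erase m \ I₁) hmj hm₂
    (fun h => hj (Finset.mem_of_mem_erase (Finset.mem_sdiff.1 h).1)) hc₂
  refine ⟨fun x y => U₁ x y * U₂ x y, r₁.mul r₂, fun x y => ?_⟩
  have := (n₁ x y).series (n₂ x y) Finset.disjoint_sdiff (by rwa [hI])
    (by simp only [Finset.mem_union, not_or]; exact ⟨hm₁, hm₂⟩)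
  rwa [hI] at this

/-- The four extra coordinates are the ends `i`, `j` of the net and the ends `i'`, `j'` of the
shear. The commutator uses the net and its inverse twice each, and six constant shears. -/
theorem NetCost.shearCost (h : NetCost r k f c) (hk : k + 4 ≤ r) :
    ShearCost r f (4 * c + 12 * 2 ^ r) := by
  intro i' j' hij
  have hcard : Fintype.card (Fin r → ZMod 2) = 2 ^ r := by simp [ZMod.card]
  have hc : (({i', j'} : Finset (Fin r))ᶜ).card = r - 2 := by
    rw [Finset.card_compl, Finset.card_pair hij, Fintype.card_fin]
  obtain ⟨T, hT, hTc⟩ := Finset.exists_subset_card_eq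
    (show 2 ≤ (({i', j'} : Finset (Fin r))ᶜ).card by omega)
  obtain ⟨i, j, hne, rfl⟩ := Finset.card_eq_two.1 hTc
  have hi := hT (show i ∈ ({i, j} : Finset _) by simp)
  have hj := hT (show j ∈ ({i, j} : Finset _) by simp)
  simp only [Finset.mem_compl, Finset.mem_insert, Finset.mem_singleton, not_or] at hi hj
  let I : Finset (Fin r) := ({i', j'} : Finset (Fin r))ᶜ \ {i, j}
  have hIc : k ≤ I.card := by
    rw [Finset.card_sdiff_of_subset hT, hc, hTc]; omega
  have hiI : i ∉ I := by simp [I]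
  have hjI : j ∉ I := by simp [I]
  have hj'I : j' ∉ I := by simp [I]
  obtain ⟨U, hU, hn⟩ := h i j I hne hiI hjI hIc
  have hs : ∀ (a b : Fin r) (hab : a ≠ b),
      Realizable (fun (_ : X) (_ : Y) => shear a b hab 1) (2 * 2 ^ r) := by
    intro a b hab
    rw [← hcard]
    exact Realizable.const _
  have hD := ((hU.mul (hs j j' hj.2)).mul hU.inv).mul (hs j j' hj.2)
  have hR := (hs i' i (Ne.symm hi.1)).mul hD
  have := hR.mul hR
  simp only [fun x y => (hn x y).commutator (Ne.symm hi.1) hj.2 hij (Ne.symm hj.1) hi.2 hne hj'I hjI] at this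
  exact this.mono (by omega)

theorem GHle.shearCost {g : X → Y → Bool} {p : ℕ} (h : GHle g p) (hp : 1 ≤ p) (r : ℕ) :
    ShearCost r (bit g) (4 * 2 ^ r * p) := by
  intro i j hij
  have hcard : Fintype.card (Fin r → ZMod 2) = 2 ^ r := by simp [ZMod.card]
  have := Realizable.control h (shear i j hij 1)
  have he : (fun x y => if g x y then shear i j hij 1 else 1) =
      fun x y => shear i j hij (bit g x y) := by
    funext x y
    cases hg : g x y <;> simp [bit, hg, shear_zero]
  rw [he, hcard] at this
  refine this.mono ?_
  have : 1 ≤ 2 ^ r := Nat.one_le_two_pow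
  nlinarith

theorem ShearCost.gHle {g : X → Y → Bool} (h : ShearCost r (bit g) c) (hr : 2 ≤ r) :
    GHle g (c + 2 ^ r) := by
  have hcard : Fintype.card (Fin r → ZMod 2) = 2 ^ r := by simp [ZMod.card]
  let i : Fin r := ⟨0, by omega⟩
  let j : Fin r := ⟨1, by omega⟩
  have hij : i ≠ j := by simp [i, j]
  have := (h i j hij).readout (Pi.single j 1) fun v => decide (v i = 1)
  rw [hcard] at this
  convert this using 3 with x y
  cases hg : g x y <;> simp [shear_apply, bit, hg, hij]

end Cost

/-! ### Binary formulae -/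

/-- Binary connectives. -/
inductive Op where
  | and
  | or
  | xor

/-- The value of a connective. -/
def Op.eval : Op → Bool → Bool → Bool
  | .and => Bool.and
  | .or => Bool.or
  | .xor => Bool.xor

/-- Binary formulae whose leaves are functions with a garden-hose protocol of known size. -/
inductive BTree (X Y : Type) where
  | leaf (f : X → Y → Bool) (p : ℕ) (hf : GHle f p) (hp : 1 ≤ p) : BTree X Y
  | node (o : Op) (l r : BTree X Y) : BTree X Y

namespace BTree

variable {X Y : Type}

/-- The function computed by a binary formula. -/
def eval : BTree X Y → X → Y → Bool
  | leaf f _ _ _ => f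
  | node o l r => fun x y => o.eval (l.eval x y) (r.eval x y)

/-- The number of leaves. -/
def size : BTree X Y → ℕ
  | leaf _ _ _ _ => 1
  | node _ l r => l.size + r.size

/-- The total size of the protocols at the leaves. -/
def weight : BTree X Y → ℕ
  | leaf _ p _ _ => p
  | node _ l r => l.weight + r.weight

theorem one_le_size (T : BTree X Y) : 1 ≤ T.size := by
  induction T with
  | leaf => simp [size]
  | node o l r hl hr => simp only [size]; omega

theorem one_le_weight (T : BTree X Y) : 1 ≤ T.weight := by
  induction T with
  | leaf f p hf hp => exact hp
  | node o l r hl hr => simp only [weight]; omega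

/-- A constant. -/
def const (b : Bool) : BTree X Y := leaf (fun _ _ => b) 1 (GHle.of_alice fun _ => b) le_rfl

/-- The map `C` replaces a fixed leaf of a fixed formula, the other leaves of which have total
number `s` and total weight `w`. -/
structure IsContext (C : BTree X Y → BTree X Y) (s w : ℕ) : Prop where
  size_eq : ∀ N, (C N).size = s + N.size
  weight_eq : ∀ N, (C N).weight = w + N.weight
  eval_congr : ∀ N N' x y, N.eval x y = N'.eval x y → (C N).eval x y = (C N').eval x y

theorem isContext_id : IsContext (id : BTree X Y → BTree X Y) 0 0 :=
  ⟨by simp, by simp, fun _ _ _ _ h => h⟩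

theorem IsContext.left {C : BTree X Y → BTree X Y} {s w : ℕ} (h : IsContext C s w) (o : Op)
    (r : BTree X Y) : IsContext (fun N => C (node o N r)) (s + r.size) (w + r.weight) :=
  ⟨fun N => by rw [h.size_eq, size]; omega, fun N => by rw [h.weight_eq, weight]; omega,
    fun N N' x y e => h.eval_congr _ _ _ _ (by simp [eval, e])⟩

theorem IsContext.right {C : BTree X Y → BTree X Y} {s w : ℕ} (h : IsContext C s w) (o : Op)
    (l : BTree X Y) : IsContext (fun N => C (node o l N)) (s + l.size) (w + l.weight) :=
  ⟨fun N => by rw [h.size_eq, size]; omega, fun N => by rw [h.weight_eq, weight]; omega,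
    fun N N' x y e => h.eval_congr _ _ _ _ (by simp [eval, e])⟩

/-- Every function of one bit is affine over `F_2`. -/
theorem IsContext.bit_eval {C : BTree X Y → BTree X Y} {s w : ℕ} (h : IsContext C s w)
    (N : BTree X Y) (x : X) (y : Y) : bit (C N).eval x y = bit (C (const false)).eval x y +
      (bit (C (const false)).eval x y + bit (C (const true)).eval x y) * bit N.eval x y := by
  cases hN : N.eval x y
  · have := h.eval_congr N (const false) x y hN
    simp [bit, this, hN]
  · have := h.eval_congr N (const true) x y hN
    simp only [bit, this, hN, if_true, mul_one]
    rw [← add_assoc, CharTwo.add_self_eq_zero, zero_add]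

/-- Descending from the root as long as the context stays smaller than `q`. -/
theorem exists_context (q : ℕ) (N : BTree X Y) : ∀ (C : BTree X Y → BTree X Y) (s w : ℕ),
    IsContext C s w → s < q → ∃ C' s' w' N', IsContext C' s' w' ∧ s' < q ∧ C' N' = C N ∧
      ((∃ f p hf hp, N' = leaf f p hf hp) ∨
        ∃ o l r, N' = node o l r ∧ q ≤ s' + l.size ∧ q ≤ s' + r.size) := by
  induction N with
  | leaf f p hf hp =>
    intro C s w hC hs
    exact ⟨C, s, w, _, hC, hs, rfl, .inl ⟨f, p, hf, hp, rfl⟩⟩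
  | node o l r hl hr =>
    intro C s w hC hs
    -- Descending moves the sibling into the context. If neither descent is allowed, each child
    -- together with the context has at least `q` leaves, which later bounds the number of inner
    -- nodes.
    by_cases h1 : s + r.size < q
    · exact hl _ _ _ (hC.left o r) h1
    by_cases h2 : s + l.size < q
    · exact hr _ _ _ (hC.right o l) h2
    exact ⟨C, s, w, _, hC, hs, rfl, .inr ⟨o, l, r, rfl, by omega, by omega⟩⟩

/-- If formulae of size `q` have cost proportional to their weight, larger formulae have nets
of proportional cost. -/
theorem exists_netCost {r α q : ℕ} (hq : 1 ≤ q)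
    (small : ∀ T : BTree X Y, T.size ≤ q → ShearCost r (bit T.eval) (α * T.weight)) (n : ℕ) :
    ∀ T : BTree X Y, T.size ≤ n → ∃ k, NetCost r k (bit T.eval) (α * (12 * T.weight - 6)) ∧
      (T.size ≤ q → k = 0) ∧ (q < T.size → (k + 2) * q ≤ 4 * T.size) := by
  induction n with
  | zero => intro T hT; have := T.one_le_size; omega
  | succ n ih =>
    intro T hT
    by_cases hTq : T.size ≤ q
    · refine ⟨0, (small T hTq).netCost.mono le_rfl ?_ fun _ _ => rfl, fun _ => rfl, fun h => by omega⟩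
      have := T.one_le_weight
      exact Nat.mul_le_mul_left _ (by omega)
    obtain ⟨C, s, w, N, hC, hs, hCN, hN⟩ := exists_context q T id 0 0 isContext_id (by omega)
    rw [id] at hCN
    have hsize := hC.size_eq N
    have hweight := hC.weight_eq N
    rw [hCN] at hsize hweight
    have hconst : ∀ b, NetCost r 0 (bit (const b : BTree X Y).eval) α := fun b => by
      have := (small (const b) hq).netCost
      rwa [const, weight, mul_one] at this
    have hCb : ∀ b, NetCost r 0 (bit (C (const b)).eval) (α * (w + 1)) := fun b => by
      have h1 : (C (const b)).size ≤ q := by rw [hC.size_eq, const, size]; omega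
      have h2 : (C (const b)).weight = w + 1 := by rw [hC.weight_eq, const, weight]
      rw [← h2]
      exact (small _ h1).netCost
    -- The context enters three times, each time with its hole filled by a constant and hence of
    -- size at most `q`.
    have combine : ∀ k c, NetCost r k (bit N.eval) c →
        NetCost r (0 + (0 + 0 + k + 1)) (bit T.eval)
          (α * (w + 1) + (α * (w + 1) + α * (w + 1) + c)) := by
      intro k c hk
      have := (hCb false).add (((hCb false).add (hCb true)).mul hk)
      convert this using 3 with x y
      rw [← hC.bit_eval, hCN]
    rcases hN with ⟨f, p, hf, hp, rfl⟩ | ⟨o, L, R, rfl, hL, hR⟩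
    · have hk := (small (leaf f p hf hp) hq).netCost
      refine ⟨_, (combine 0 _ hk).mono le_rfl ?_ fun _ _ => rfl, fun h => by omega, fun _ => by omega⟩
      rw [weight] at hweight ⊢
      have : 3 * (w + 1) + p ≤ 12 * T.weight - 6 := by omega
      nlinarith
    · rw [size] at hsize
      rw [weight] at hweight
      have hL1 := L.one_le_size
      have hR1 := R.one_le_size
      have hLw := L.one_le_weight
      have hRw := R.one_le_weight
      obtain ⟨kL, nL, zL, bL⟩ := ih L (by omega)
      obtain ⟨kR, nR, zR, bR⟩ := ih R (by omega)
      -- The term `3 * α` is needed for OR, written as `1 + (1 + L) * (1 + R)` with three constants.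
      have hnode : NetCost r (kL + kR + 1) (bit (node o L R).eval)
          (α * (12 * L.weight - 6) + α * (12 * R.weight - 6) + 3 * α) := by
        cases o with
        | and =>
          refine (nL.mul nR).mono le_rfl (by omega) fun x y => ?_
          cases hl : L.eval x y <;> cases hr : R.eval x y <;> simp [bit, eval, Op.eval, hl, hr]
        | or =>
          refine ((hconst true).add (((hconst true).add nL).mul ((hconst true).add nR))).mono
            (by omega) (by omega) fun x y => ?_
          cases hl : L.eval x y <;> cases hr : R.eval x y <;>
            simp [bit, eval, Op.eval, hl, hr, const, CharTwo.add_self_eq_zero]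
        | xor =>
          refine (nL.add nR).mono (by omega) (by omega) fun x y => ?_
          cases hl : L.eval x y <;> cases hr : R.eval x y <;>
            simp [bit, eval, Op.eval, hl, hr, CharTwo.add_self_eq_zero]
      refine ⟨_, (combine _ _ hnode).mono le_rfl ?_ fun _ _ => rfl, fun h => by omega, fun _ => ?_⟩
      -- Two subtracted sixes come from the children and only one is owed. The other pays for six
      -- constants: three in the contexts and three in an OR.
      · have : 3 * (w + 1) + (12 * L.weight - 6) + (12 * R.weight - 6) + 3 ≤
          12 * T.weight - 6 := by omega
        nlinarith
      · have e : (0 + (0 + 0 + (kL + kR + 1) + 1) + 2) * q = (kL + 2) * q + (kR + 2) * q := by ring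
        rw [e]
        -- A child of size at most `q` has no inner nodes but still contributes `2 * q`; the
        -- stopping condition of the descent pays for it.
        by_cases h1 : L.size ≤ q <;> by_cases h2 : R.size ≤ q
        · rw [zL h1, zR h2]; omega
        · have := bR (by omega); rw [zL h1]; omega
        · have := bL (by omega); rw [zR h2]; omega
        · have := bL (by omega); have := bR (by omega); omega

/-- The factor is `48 = 4 * 12`, from the commutator and from the net. The ratio `K` of sizes
affects only the number of coordinates needed. -/
theorem shearCost_step {r α q K : ℕ} (hq : 1 ≤ q) (hα : 2 * 2 ^ r ≤ α) (hr : 4 * K + 2 ≤ r)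
    (hK : 1 ≤ K)
    (small : ∀ T : BTree X Y, T.size ≤ q → ShearCost r (bit T.eval) (α * T.weight))
    (T : BTree X Y) (hT : T.size ≤ K * q) : ShearCost r (bit T.eval) (48 * α * T.weight) := by
  obtain ⟨k, hk, h0, h1⟩ := exists_netCost hq small _ T le_rfl
  have hkr : k + 4 ≤ r := by
    by_cases h : T.size ≤ q
    · rw [h0 h]; omega
    · have := h1 (by omega)
      have : (k + 2) * q ≤ (4 * K) * q := by nlinarith
      have := Nat.le_of_mul_le_mul_right this (by omega)
      omega
  intro i j hij
  refine (hk.shearCost hkr i j hij).mono ?_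
  have hw := T.one_le_weight
  obtain ⟨u, hu⟩ : ∃ u, 12 * T.weight = u + 6 := ⟨12 * T.weight - 6, by omega⟩
  have : 48 * α * T.weight = α * (4 * (12 * T.weight)) := by ring
  rw [this, hu, Nat.add_sub_cancel]
  nlinarith

theorem shearCost_of_size_le_pow {r K : ℕ} (hr : 4 * K + 2 ≤ r) (hK : 1 ≤ K) (d : ℕ) :
    ∀ T : BTree X Y, T.size ≤ K ^ d → ShearCost r (bit T.eval) (48 ^ d * (4 * 2 ^ r) * T.weight) := by
  induction d with
  | zero =>
    intro T hT
    cases T with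
    | leaf f p hf hp => simpa [eval, weight] using hf.shearCost hp r
    | node o L R =>
      have := L.one_le_size
      have := R.one_le_size
      simp only [size, pow_zero] at hT
      omega
  | succ d ih =>
    intro T hT
    have h48 : 1 ≤ 48 ^ d := Nat.one_le_pow _ _ (by norm_num)
    have := shearCost_step (K := K) (Nat.one_le_pow _ _ hK) (by nlinarith [h48, Nat.zero_le (2 ^ r)])
      hr hK ih T (by rw [pow_succ] at hT; linarith)
    convert this using 1
    ring

end BTree

/-- Formulae of size `s` have garden-hose complexity at most `C s ^ (1 / h)` times the total
garden-hose complexity of their leaves. -/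
theorem exists_treeFactor (h : ℕ) (hh : 1 ≤ h) : ∃ C : ℕ, ∀ s : ℕ, 1 ≤ s → ∃ t : ℕ, 1 ≤ t ∧
    t ^ h ≤ C * s ∧ ∀ (X Y : Type) (T : BTree X Y), T.size ≤ s → GHle T.eval (t * T.weight) := by
  -- About `log_K s` rounds at a factor `48 = K ^ (1 / h)` each give `s ^ (1 / h)`; `r` and `α`
  -- depend on `h` alone.
  let K := 48 ^ h
  let r := 4 * K + 2
  let α := 4 * 2 ^ r
  have hα : 1 ≤ α := Nat.mul_pos (by norm_num) (Nat.two_pow_pos r)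
  have hK : 1 < K := Nat.one_lt_pow (by omega) (by norm_num)
  -- In `96 = 2 * 48` the `2` absorbs the wires added by the readout and the `48` the rounding up of
  -- the logarithm.
  refine ⟨(96 * α) ^ h, fun s hs => ⟨2 * 48 ^ Nat.clog K s * α, ?_, ?_, fun X Y T hT => ?_⟩⟩
  · have : 1 ≤ 48 ^ Nat.clog K s := Nat.one_le_pow _ _ (by norm_num)
    nlinarith
  · have key : (48 ^ Nat.clog K s) ^ h ≤ 48 ^ h * s := by
      rcases Nat.eq_zero_or_pos (Nat.clog K s) with h0 | h0
      · rw [h0, pow_zero, one_pow]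
        exact Nat.mul_pos (by positivity) hs
      · have h1 : K ^ (Nat.clog K s - 1) < s := by
          apply Nat.pow_pred_clog_lt_self hK
          by_contra hs1
          rw [Nat.clog_of_right_le_one (by omega)] at h0
          omega
        obtain ⟨d, hd⟩ : ∃ d, Nat.clog K s = d + 1 := ⟨Nat.clog K s - 1, by omega⟩
        rw [hd, Nat.add_sub_cancel] at h1
        rw [hd, pow_succ, mul_pow, ← pow_mul, mul_comm d h, pow_mul, mul_comm]
        exact Nat.mul_le_mul_left _ h1.le
    calc (2 * 48 ^ Nat.clog K s * α) ^ h = (2 * α) ^ h * (48 ^ Nat.clog K s) ^ h := by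
          rw [← mul_pow]; congr 1; ring
      _ ≤ (2 * α) ^ h * (48 ^ h * s) := Nat.mul_le_mul_left _ key
      _ = (96 * α) ^ h * s := by
          rw [← mul_assoc, ← mul_pow]; congr 2; ring
  · have := (BTree.shearCost_of_size_le_pow (r := r) le_rfl hK.le (Nat.clog K s) T
      (hT.trans (Nat.le_pow_clog hK s))).gHle (by omega)
    refine this.mono ?_
    have h1 : 1 ≤ 48 ^ Nat.clog K s := Nat.one_le_pow _ _ (by norm_num)
    have h2 := T.one_le_weight
    have h3 : 2 ^ r ≤ α := by simp only [α]; omega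
    have h4 : α ≤ 48 ^ Nat.clog K s * α * T.weight := by
      calc α = 1 * α * 1 := by ring
        _ ≤ _ := Nat.mul_le_mul (Nat.mul_le_mul_right _ h1) h2
    calc _ ≤ 48 ^ Nat.clog K s * α * T.weight + 48 ^ Nat.clog K s * α * T.weight :=
          Nat.add_le_add_left (h3.trans h4) _
      _ = _ := by ring

/-! ### Counting modulo small numbers -/

section Counting

variable {X Y : Type} {m : ℕ} (f : Fin m → X → Y → Bool)

/-- The number of functions with value `true`. -/
def count (x : X) (y : Y) : ℕ := (Finset.univ.filter fun i => f i x y = true).card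

variable {f} {p : Fin m → ℕ}

theorem realizable_pow_count {S : Type} [Fintype S] (hf : ∀ i, GHle (f i) (p i))
    (π : Equiv.Perm S) : Realizable (fun x y => π ^ count f x y)
      (∑ i, 2 * Fintype.card S * (p i + 1) + 2 * Fintype.card S) := by
  classical
  have key : ∀ t : Finset (Fin m), Realizable
      (fun x y => π ^ (t.filter fun i => f i x y = true).card)
      (∑ i ∈ t, 2 * Fintype.card S * (p i + 1) + 2 * Fintype.card S) := by
    intro t
    induction t using Finset.induction_on with
    | empty => simpa using Realizable.const (X := X) (Y := Y) (1 : Equiv.Perm S)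
    | insert i t hi ih =>
      rw [Finset.sum_insert hi, add_assoc]
      have := (Realizable.control (hf i) π).mul ih
      convert this using 3 with x y
      rw [Finset.filter_insert]
      cases hfi : f i x y
      · simp
      · simp [Finset.card_insert_of_notMem, hi, pow_succ']
  exact key Finset.univ

/-- A cycle on the first `q` states: one register with `P` states serves all moduli up to `P`. -/
theorem exists_perm_pow_apply_zero {P q : ℕ} [NeZero P] (hq : 0 < q) (hqP : q ≤ P) :
    ∃ ρ : Equiv.Perm (Fin P), ∀ n, ((ρ ^ n) 0).val = n % q := by
  refine ⟨Fin.cycleRange ⟨q - 1, by omega⟩, fun n => ?_⟩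
  induction n with
  | zero => simp
  | succ n ih =>
    rw [pow_succ', Equiv.Perm.mul_apply]
    have hlt := Nat.mod_lt n hq
    by_cases h : n % q = q - 1
    · have e : (Fin.cycleRange (⟨q - 1, by omega⟩ : Fin P) ^ n) 0 = ⟨q - 1, by omega⟩ :=
        Fin.ext (by rw [ih, h])
      rw [e, Fin.cycleRange_self, Nat.add_mod, h]
      rcases Nat.lt_or_ge 1 q with h1 | h1
      · rw [Nat.mod_eq_of_lt h1, Nat.sub_add_cancel hq, Nat.mod_self]; rfl
      · obtain rfl : q = 1 := by omega
        simp
    · have hl : (Fin.cycleRange (⟨q - 1, by omega⟩ : Fin P) ^ n) 0 < ⟨q - 1, by omega⟩ := by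
        rw [Fin.lt_def, ih]
        change n % q < q - 1
        omega
      rw [Fin.coe_cycleRange_of_lt hl, ih]
      have h1 : n + 1 = (n % q + 1) + q * (n / q) := by
        have := Nat.mod_add_div n q
        omega
      conv_rhs => rw [h1, Nat.add_mul_mod_self_left]
      exact (Nat.mod_eq_of_lt (by omega)).symm

theorem prodCongr_pow {A B : Type} (ρ : Equiv.Perm A) (n : ℕ) (v : A × B) :
    ((Equiv.prodCongr ρ (Equiv.refl B) : Equiv.Perm (A × B)) ^ n) v = ((ρ ^ n) v.1, v.2) := by
  induction n with
  | zero => simp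
  | succ n ih => rw [pow_succ', Equiv.Perm.mul_apply, ih, pow_succ', Equiv.Perm.mul_apply]; rfl

variable {P Q : ℕ} [NeZero P] [NeZero Q]

/-- A function of the count modulo `q` can be added to an accumulator. -/
theorem exists_realizable_add (hf : ∀ i, GHle (f i) (p i)) (hp : ∀ i, 1 ≤ p i) (hm : 1 ≤ m)
    {q : ℕ} (hq : 0 < q) (hqP : q ≤ P) (h : ℕ → ZMod Q) (hh : ∀ n, h (n % q) = h n) :
    ∃ σ : X → Y → Equiv.Perm (Fin P × ZMod Q), Realizable σ (14 * (P * Q * ∑ i, p i)) ∧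
      ∀ x y a, σ x y (0, a) = (0, a + h (count f x y)) := by
  obtain ⟨ρ, hρ⟩ := exists_perm_pow_apply_zero hq hqP
  let π : Equiv.Perm (Fin P × ZMod Q) := Equiv.prodCongr ρ (Equiv.refl _)
  let τ : Equiv.Perm (Fin P × ZMod Q) :=
    Equiv.prodShear (Equiv.refl _) fun c => Equiv.addRight (h c.val)
  have hinc := realizable_pow_count hf π
  -- Compute the residue, add its value to the accumulator, uncompute; the counter is back at `0`
  -- for the next modulus.
  refine ⟨_, (hinc.inv.mul ((Realizable.const τ).mul hinc)).mono ?_, fun x y a => ?_⟩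
  · have hc : Fintype.card (Fin P × ZMod Q) = P * Q := by simp [ZMod.card]
    have h1 : m ≤ ∑ i, p i := by
      calc m = ∑ _i : Fin m, 1 := by simp
        _ ≤ _ := Finset.sum_le_sum fun i _ => hp i
    rw [hc, ← Finset.mul_sum, Finset.sum_add_distrib]
    simp only [Finset.sum_const, Finset.card_univ, Fintype.card_fin, smul_eq_mul, mul_one]
    have h2 : P * Q * m ≤ P * Q * ∑ i, p i := Nat.mul_le_mul_left _ h1
    have h3 : P * Q * 1 ≤ P * Q * ∑ i, p i := Nat.mul_le_mul_left _ (hm.trans h1)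
    nlinarith
  · rw [Equiv.Perm.mul_apply, Equiv.Perm.inv_def, Equiv.symm_apply_eq, Equiv.Perm.mul_apply,
      prodCongr_pow, prodCongr_pow]
    simp only [τ, Equiv.prodShear_apply, Equiv.refl_apply, Equiv.coe_addRight, hρ, hh]

theorem exists_realizable_sum (hf : ∀ i, GHle (f i) (p i)) (hp : ∀ i, 1 ≤ p i) (hm : 1 ≤ m)
    {q : ℕ → ℕ} {h : ℕ → ℕ → ZMod Q} (j : ℕ) (hq : ∀ i < j, 0 < q i) (hqP : ∀ i < j, q i ≤ P)
    (hh : ∀ i < j, ∀ n, h i (n % q i) = h i n) :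
    ∃ σ : X → Y → Equiv.Perm (Fin P × ZMod Q),
      Realizable σ (14 * (P * Q * ∑ i, p i) * j + 2 * (P * Q)) ∧
      ∀ x y a, σ x y (0, a) = (0, a + ∑ i ∈ Finset.range j, h i (count f x y)) := by
  induction j with
  | zero =>
    have hc : Fintype.card (Fin P × ZMod Q) = P * Q := by simp [ZMod.card]
    refine ⟨_, (Realizable.const 1).mono (by rw [hc]; omega), by simp⟩
  | succ j ih =>
    obtain ⟨σ, h1, h2⟩ := ih (fun i hi => hq i (by omega)) (fun i hi => hqP i (by omega))
      fun i hi => hh i (by omega)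
    obtain ⟨τ, h3, h4⟩ := exists_realizable_add hf hp hm (hq j (by omega)) (hqP j (by omega)) (h j)
      (hh j (by omega))
    refine ⟨_, (h3.mul h1).mono (by rw [mul_add]; omega), fun x y a => ?_⟩
    rw [Equiv.Perm.mul_apply, h2, h4, Finset.sum_range_succ, add_assoc]

theorem gHle_sum (hf : ∀ i, GHle (f i) (p i)) (hp : ∀ i, 1 ≤ p i) (hm : 1 ≤ m)
    {q : ℕ → ℕ} {h : ℕ → ℕ → ZMod Q} {j k : ℕ} (hjk : j ≤ k) (hk : 1 ≤ k)
    (hq : ∀ i < j, 0 < q i) (hqP : ∀ i < j, q i ≤ P)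
    (hh : ∀ i < j, ∀ n, h i (n % q i) = h i n) (dec : ZMod Q → Bool) :
    GHle (fun x y => dec (∑ i ∈ Finset.range j, h i (count f x y)))
      (17 * k * (P * Q * ∑ i, p i)) := by
  obtain ⟨σ, h1, h2⟩ := exists_realizable_sum hf hp hm j hq hqP hh
  have := h1.readout (0, 0) fun v => dec v.2
  simp only [h2, zero_add] at this
  refine this.mono ?_
  have hc : Fintype.card (Fin P × ZMod Q) = P * Q := by simp [ZMod.card]
  have h3 : 1 ≤ ∑ i, p i := by
    calc 1 ≤ ∑ _i : Fin m, 1 := by simpa using hm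
      _ ≤ _ := Finset.sum_le_sum fun i _ => hp i
  have h4 : P * Q * 1 ≤ P * Q * ∑ i, p i := Nat.mul_le_mul_left _ h3
  rw [hc]
  generalize P * Q * ∑ i, p i = w at *
  nlinarith [Nat.mul_le_mul_left w hjk, Nat.mul_le_mul_left w hk]

end Counting

/-! ### Sign tests by Chinese remaindering -/

section Remainders

/-- Partial fractions: division by the product `M` of the moduli gives `d / M = ∑ e i * d / q i`. -/
theorem exists_partialFractions {q : ℕ → ℕ} {j : ℕ} (hj : 1 ≤ j)
    (hq : ∀ i < j, ∀ l < j, i ≠ l → Nat.Coprime (q i) (q l)) :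
    ∃ e : ℕ → ℤ, ∑ i ∈ Finset.range j, e i * ∏ l ∈ Finset.range j \ {i}, (q l : ℤ) = 1 := by
  refine (exists_sum_eq_one_iff_pairwise_coprime (Finset.nonempty_range_iff.2 (by omega))).2 ?_
  rintro ⟨i, hi⟩ ⟨l, hl⟩ hil
  exact Nat.isCoprime_iff_coprime.2 (hq i (Finset.mem_range.1 hi) l (Finset.mem_range.1 hl)
    fun h => hil (Subtype.ext h))

/-- Each of the `j` floors loses less than `1`, so their sum `A` satisfies `A ≤ Q * d / M < A + j`.
-/
theorem sum_ediv_bounds {q : ℕ → ℕ} {j : ℕ} (hj : 1 ≤ j) (hq : ∀ i < j, 0 < q i) {e : ℕ → ℤ}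
    (he : ∑ i ∈ Finset.range j, e i * ∏ l ∈ Finset.range j \ {i}, (q l : ℤ) = 1) (Q d : ℤ) :
    (∏ i ∈ Finset.range j, (q i : ℤ)) * ∑ i ∈ Finset.range j, Q * e i * d / q i ≤ Q * d ∧
      Q * d < (∏ i ∈ Finset.range j, (q i : ℤ)) *
        (∑ i ∈ Finset.range j, Q * e i * d / q i + j) := by
  have hsum : Q * d = ∑ i ∈ Finset.range j,
      Q * e i * d * ∏ l ∈ Finset.range j \ {i}, (q l : ℤ) := by
    calc Q * d = Q * d * ∑ i ∈ Finset.range j, e i * ∏ l ∈ Finset.range j \ {i}, (q l : ℤ) := by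
          rw [he, mul_one]
      _ = _ := by rw [Finset.mul_sum]; exact Finset.sum_congr rfl fun i _ => by ring
  have hprod : ∀ i ∈ Finset.range j, ∏ l ∈ Finset.range j, (q l : ℤ) =
      q i * ∏ l ∈ Finset.range j \ {i}, (q l : ℤ) := fun i hi => by
    rw [Finset.sdiff_singleton_eq_erase, Finset.mul_prod_erase _ (fun l => (q l : ℤ)) hi]
  have hpos : ∀ i, 0 < ∏ l ∈ Finset.range j \ {i}, (q l : ℤ) := fun i =>
    Finset.prod_pos fun l hl => by
      have := hq l (Finset.mem_range.1 (Finset.mem_sdiff.1 hl).1)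
      exact_mod_cast this
  have hj' : (j : ℤ) = ∑ _i ∈ Finset.range j, (1 : ℤ) := by simp
  constructor
  · rw [hsum, Finset.mul_sum]
    refine Finset.sum_le_sum fun i hi => ?_
    rw [hprod i hi, mul_right_comm]
    have hqi : (0 : ℤ) < q i := by exact_mod_cast hq i (Finset.mem_range.1 hi)
    exact mul_le_mul_of_nonneg_right (Int.mul_ediv_self_le hqi.ne') (hpos i).le
  · rw [hsum, hj', ← Finset.sum_add_distrib, Finset.mul_sum]
    refine Finset.sum_lt_sum_of_nonempty (Finset.nonempty_range_iff.2 (by omega)) fun i hi => ?_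
    rw [hprod i hi, mul_right_comm (q i : ℤ)]
    have hqi : (0 : ℤ) < q i := by exact_mod_cast hq i (Finset.mem_range.1 hi)
    refine mul_lt_mul_of_pos_right ?_ (hpos i)
    have := Int.lt_mul_ediv_self_add (x := Q * e i * d) hqi
    linarith

/-- The Chinese remainder representation `∑ i, e i * d / q i` of `d / M`, rounded to multiples
of `1 / Q`, either reveals the sign of `d` or shows that `d` is small. -/
theorem sign_test {M M' A Q d q : ℤ} {j k P : ℕ} (hM : M = M' * q) (hM' : 0 < M')
    (hq : 0 < q) (hqP : q ≤ P) (hj : 1 ≤ j) (hjk : j ≤ k) (hQ : Q = 4 * k * P)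
    (h1 : M * A ≤ Q * d) (h2 : Q * d < M * (A + j)) (hd : 4 * |d| < M) :
    A * 2 ∈ Set.Ioc (-Q) Q ∧ (0 ≤ A → 0 ≤ d) ∧ (A ≤ -j → d < 0) ∧
      (-j < A → A < 0 → 4 * |d| < M') := by
  have hMpos : 0 < M := by rw [hM]; positivity
  have hP : (1 : ℤ) ≤ P := by omega
  have hk : (1 : ℤ) ≤ k := by exact_mod_cast hj.trans hjk
  have hjk' : (j : ℤ) ≤ k := by exact_mod_cast hjk
  have hQk : 4 * (k : ℤ) ≤ Q := by rw [hQ]; nlinarith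
  have hQpos : 0 < Q := by linarith
  have hdl := neg_abs_le d
  have hdu := le_abs_self d
  refine ⟨⟨?_, ?_⟩, fun hA => ?_, fun hA => ?_, fun hA1 hA2 => ?_⟩
  · have : M * (-Q) < M * (4 * (A + j)) := by nlinarith
    have := lt_of_mul_lt_mul_left this hMpos.le
    linarith
  · have : M * (4 * A) < M * Q := by nlinarith
    have := lt_of_mul_lt_mul_left this hMpos.le
    linarith
  · by_contra hneg
    have : Q * d < 0 := mul_neg_of_pos_of_neg hQpos (by linarith)
    have : 0 ≤ M * A := by positivity
    linarith
  · by_contra hneg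
    have : 0 ≤ Q * d := mul_nonneg hQpos.le (by linarith)
    have : M * (A + j) ≤ 0 := mul_nonpos_of_nonneg_of_nonpos hMpos.le (by linarith)
    linarith
  · have hb : Q * |d| < M * j := by
      rcases abs_cases d with ⟨h, _⟩ | ⟨h, _⟩ <;> rw [h] <;> nlinarith
    -- Here `Q = 4 * k * P` is used: the precision makes up for the rounding error `j ≤ k` and for
    -- the lost modulus `q ≤ P`.
    have hb' : (k * P : ℤ) * (4 * |d|) < (k * P : ℤ) * M' := by
      calc (k * P : ℤ) * (4 * |d|) = Q * |d| := by rw [hQ]; ring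
        _ < M * j := hb
        _ = M' * (q * j) := by rw [hM]; ring
        _ ≤ M' * (P * k) := by
            refine mul_le_mul_of_nonneg_left (mul_le_mul hqP hjk' (by omega) (by omega)) hM'.le
        _ = _ := by ring
    exact lt_of_mul_lt_mul_left hb' (by positivity)

/-- Shifting the count by a multiple of `q` shifts the quotient by a multiple of `Q`, so a counter
modulo `q` suffices. -/
theorem ediv_add_mod_cast {Q q : ℕ} (hq : 0 < q) (e m : ℤ) (n : ℕ) :
    ((Q * e * (2 * ((n % q : ℕ) : ℤ) - m) / q : ℤ) : ZMod Q) =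
      ((Q * e * (2 * (n : ℤ) - m) / q : ℤ) : ZMod Q) := by
  have hq' : (q : ℤ) ≠ 0 := by exact_mod_cast hq.ne'
  have hn : (n : ℤ) = ((n % q : ℕ) : ℤ) + q * ((n / q : ℕ) : ℤ) := by
    exact_mod_cast (Nat.mod_add_div n q).symm
  have : Q * e * (2 * (n : ℤ) - m) =
      Q * e * (2 * ((n % q : ℕ) : ℤ) - m) + (Q * (2 * e * ((n / q : ℕ) : ℤ))) * q := by
    conv_lhs => rw [hn]
    ring
  rw [this, Int.add_mul_ediv_right _ _ hq']
  push_cast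
  simp

end Remainders

/-! ### Majority -/

section Majority

variable {X Y : Type} {m : ℕ} {f : Fin m → X → Y → Bool} {p : Fin m → ℕ}

theorem exists_majority_tree (hf : ∀ i, GHle (f i) (p i)) (hp : ∀ i, 1 ≤ p i) (hm : 1 ≤ m)
    {k P Q : ℕ} (hP : 0 < P) (hk : 1 ≤ k) (hQ : Q = 4 * k * P) {q : ℕ → ℕ} (hq : ∀ i < k, 0 < q i)
    (hqP : ∀ i < k, q i ≤ P) (hc : ∀ i < k, ∀ l < k, i ≠ l → Nat.Coprime (q i) (q l)) (j : ℕ) :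
    j ≤ k → ∃ T : BTree X Y, T.size = 2 * j + 1 ∧
      T.weight = 2 * j * (17 * k * (P * Q * ∑ i, p i)) + 1 ∧
      ∀ x y, 4 * |2 * (count f x y : ℤ) - m| < ∏ i ∈ Finset.range j, (q i : ℤ) →
        T.eval x y = decide (0 ≤ 2 * (count f x y : ℤ) - m) := by
  have : NeZero P := ⟨hP.ne'⟩
  have : NeZero Q := ⟨by rw [hQ]; positivity⟩
  have hW : 1 ≤ 17 * k * (P * Q * ∑ i, p i) := by
    have h3 : 1 ≤ ∑ i, p i := by
      calc 1 ≤ ∑ _i : Fin m, 1 := by simpa using hm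
        _ ≤ _ := Finset.sum_le_sum fun i _ => hp i
    have : 0 < Q := Nat.pos_of_neZero Q
    exact Nat.succ_le_of_lt (by positivity)
  induction j with
  | zero =>
    intro _
    refine ⟨BTree.const true, rfl, by simp [BTree.const, BTree.weight], fun x y h => ?_⟩
    have h0 : |2 * (count f x y : ℤ) - m| < 1 := by
      simp only [Finset.range_zero, Finset.prod_empty] at h
      omega
    rw [Int.abs_lt_one_iff.1 h0]
    rfl
  | succ j ih =>
    intro hjk
    obtain ⟨T, h1, h2, h3⟩ := ih (by omega)
    obtain ⟨e, he⟩ := exists_partialFractions (q := q) (j := j + 1) (by omega)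
      fun i hi l hl => hc i (by omega) l (by omega)
    let h : ℕ → ℕ → ZMod Q := fun i n => ((Q * e i * (2 * (n : ℤ) - m) / q i : ℤ) : ZMod Q)
    have hh : ∀ i < j + 1, ∀ n, h i (n % q i) = h i n := fun i hi n =>
      ediv_add_mod_cast (hq i (by omega)) (e i) m n
    have test := gHle_sum hf hp hm (h := h) hjk hk (fun i hi => hq i (by omega))
      (fun i hi => hqP i (by omega)) hh
    -- Accept if `0 ≤ A`, reject if `A ≤ -(j + 1)`, and otherwise use the test with `j` moduli.
    refine ⟨.node .or (.leaf _ _ (test fun a => decide (0 ≤ a.valMinAbs)) hW)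
      (.node .and (.leaf _ _ (test fun a => decide (-((j + 1 : ℕ) : ℤ) < a.valMinAbs)) hW) T),
      ?_, ?_, fun x y hxy => ?_⟩
    · simp only [BTree.size, h1]; omega
    · simp only [BTree.weight, h2]; ring
    · have hb := sum_ediv_bounds (q := q) (j := j + 1) (by omega) (fun i hi => hq i (by omega)) he Q
        (2 * (count f x y : ℤ) - m)
      have hpos : (0 : ℤ) < ∏ i ∈ Finset.range j, (q i : ℤ) :=
        Finset.prod_pos fun i hi => by
          have := hq i (by have := Finset.mem_range.1 hi; omega)
          exact_mod_cast this
      have hs := sign_test (Finset.prod_range_succ _ _) hpos (by exact_mod_cast hq j (by omega))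
        (by exact_mod_cast hqP j (by omega)) (by omega) hjk (by exact_mod_cast hQ) hb.1 hb.2 hxy
      -- The accumulator knows `A` only modulo `Q`; by its range, `A` is the representative of least
      -- absolute value.
      have ha : (∑ i ∈ Finset.range (j + 1), h i (count f x y)).valMinAbs =
          ∑ i ∈ Finset.range (j + 1), Q * e i * (2 * (count f x y : ℤ) - m) / q i := by
        rw [ZMod.valMinAbs_spec]
        exact ⟨by simp [h], hs.1⟩
      simp only [BTree.eval, Op.eval, ha]
      generalize ∑ i ∈ Finset.range (j + 1), Q * e i * (2 * (count f x y : ℤ) - m) / q i = A at hs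
      have h3' := h3 x y
      generalize 2 * (count f x y : ℤ) - m = d at hs h3'
      obtain ⟨_, s1, s2, s3⟩ := hs
      by_cases hA : 0 ≤ A
      · simp [hA, s1 hA]
      · by_cases hA' : -((j + 1 : ℕ) : ℤ) < A
        · simp only [hA, hA', decide_false, decide_true, Bool.false_or, Bool.true_and]
          exact h3' (s3 hA' (by omega))
        · have := s2 (by omega)
          simp only [hA, hA', decide_false, Bool.false_or, Bool.false_and]
          simpa using this

/-- Iterating Bertrand's postulate gives distinct primes, each at most twice its predecessor. -/
theorem exists_coprime_sequence (b : ℕ) (hb : 1 ≤ b) (k : ℕ) : ∃ q : ℕ → ℕ,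
    (∀ i, b ≤ q i) ∧ (∀ i < k, q i ≤ 2 ^ k * b) ∧
      ∀ i < k, ∀ l < k, i ≠ l → Nat.Coprime (q i) (q l) := by
  have step : ∀ n : ℕ, ∃ r, n ≠ 0 → Nat.Prime r ∧ n < r ∧ r ≤ 2 * n := by
    intro n
    by_cases hn : n = 0
    · exact ⟨0, fun h => absurd hn h⟩
    · obtain ⟨r, hr⟩ := Nat.exists_prime_lt_and_le_two_mul n hn
      exact ⟨r, fun _ => hr⟩
  choose nxt hnxt using step
  let a : ℕ → ℕ := fun i => nxt^[i] b
  have ha : ∀ i, a (i + 1) = nxt (a i) := fun i => Function.iterate_succ_apply' nxt i b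
  have hab : ∀ i, b ≤ a i ∧ a i ≤ 2 ^ i * b := by
    intro i
    induction i with
    | zero => simp [a]
    | succ i ih =>
      have := hnxt (a i) (by omega)
      rw [ha, pow_succ]
      constructor
      · omega
      · nlinarith
  have hmono : StrictMono a := strictMono_nat_of_lt_succ fun i => by
    rw [ha]
    exact (hnxt (a i) (by have := hab i; omega)).2.1
  have hprime : ∀ i, Nat.Prime (a (i + 1)) := fun i => by
    rw [ha]
    exact (hnxt (a i) (by have := hab i; omega)).1
  refine ⟨fun i => a (i + 1), fun i => (hab _).1, fun i hi => (hab _).2.trans ?_, fun i _ l _ hil =>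
    (Nat.coprime_primes (hprime i) (hprime l)).2 fun h => hil ?_⟩
  · exact Nat.mul_le_mul_right _ (Nat.pow_le_pow_right (by norm_num) hi)
  · have := hmono.injective h
    omega

end Majority

/-- The majority of at most `s` functions has garden-hose complexity at most `C s ^ (1 / h)`
times their total garden-hose complexity. -/
theorem exists_majorityFactor (h : ℕ) (hh : 1 ≤ h) : ∃ C : ℕ, ∀ s : ℕ, 1 ≤ s → ∃ t : ℕ, 1 ≤ t ∧
    t ^ h ≤ C * s ∧ ∀ (X Y : Type) (m : ℕ) (f : Fin m → X → Y → Bool) (p : Fin m → ℕ),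
      1 ≤ m → m ≤ s → (∀ i, GHle (f i) (p i)) → (∀ i, 1 ≤ p i) →
      GHle (fun x y => decide (m ≤ 2 * count f x y)) (t * ∑ i, p i) := by
  -- There are `P * Q = O(b ^ 2)` wires with `b ^ k` of order `s`, so `k = 2 * h` makes this `O(s ^
  -- (1 / h))`.
  let k := 2 * h
  obtain ⟨C₀, hC₀⟩ := exists_treeFactor 1 le_rfl
  -- The tree of sign tests has `2 * k + 1` leaves, a number independent of `s`, so its factor is a
  -- constant.
  obtain ⟨t₀, ht₀, -, htree⟩ := hC₀ (2 * k + 1) (by omega)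
  let B := t₀ * (35 * k * k * (4 * k * 4 ^ k))
  refine ⟨B ^ h * (2 ^ k * 4), fun s hs => ?_⟩
  have hex : ∃ b, 4 * s < b ^ k := ⟨4 * s + 1, lt_of_lt_of_le (Nat.lt_succ_self _)
    (Nat.le_self_pow (by omega) _)⟩
  classical
  let b := Nat.find hex
  have hb : 4 * s < b ^ k := Nat.find_spec hex
  have hb2 : 2 ≤ b := by
    by_contra hlt
    have : b ^ k ≤ 1 ^ k := Nat.pow_le_pow_left (by omega) k
    rw [one_pow] at this
    omega
  have hb' : (b - 1) ^ k ≤ 4 * s := not_lt.1 (Nat.find_min hex (by omega : b - 1 < b))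
  have hbk : b ^ k ≤ 2 ^ k * 4 * s := by
    calc b ^ k ≤ (2 * (b - 1)) ^ k := Nat.pow_le_pow_left (by omega) k
      _ = 2 ^ k * (b - 1) ^ k := mul_pow _ _ _
      _ ≤ 2 ^ k * (4 * s) := Nat.mul_le_mul_left _ hb'
      _ = _ := by ring
  have hk : 1 ≤ k := by omega
  have hBpos : 1 ≤ B := Nat.succ_le_of_lt (by positivity)
  refine ⟨B * b ^ 2, Nat.succ_le_of_lt (by positivity), ?_, fun X Y m f p hm hms hf hp => ?_⟩
  · calc (B * b ^ 2) ^ h = B ^ h * b ^ k := by rw [mul_pow, ← pow_mul]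
      _ ≤ B ^ h * (2 ^ k * 4 * s) := Nat.mul_le_mul_left _ hbk
      _ = _ := by ring
  · obtain ⟨q, hqb, hqP, hqc⟩ := exists_coprime_sequence b (by omega) k
    obtain ⟨T, hT1, hT2, hT3⟩ := exists_majority_tree hf hp hm (P := 2 ^ k * b)
      (Q := 4 * k * (2 ^ k * b)) (by positivity) hk rfl (fun i _ => (by omega : 0 < b).trans_le (hqb i))
      hqP hqc k le_rfl
    have hprod : ((b : ℤ)) ^ k ≤ ∏ i ∈ Finset.range k, (q i : ℤ) := by
      have : b ^ k ≤ ∏ i ∈ Finset.range k, q i := by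
        calc b ^ k = ∏ _i ∈ Finset.range k, b := by simp
          _ ≤ _ := Finset.prod_le_prod' fun i _ => hqb i
      exact_mod_cast this
    have heq : T.eval = fun x y => decide (m ≤ 2 * count f x y) := by
      funext x y
      have hcount : count f x y ≤ m := by
        have := Finset.card_filter_le (Finset.univ : Finset (Fin m)) fun i => f i x y = true
        rwa [Finset.card_univ, Fintype.card_fin] at this
      rw [hT3 x y]
      · rw [decide_eq_decide]; omega
      · refine lt_of_lt_of_le ?_ hprod
        have : (4 * s : ℤ) < (b : ℤ) ^ k := by exact_mod_cast hb
        have : |2 * (count f x y : ℤ) - m| ≤ m := by rw [abs_le]; constructor <;> omega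
        omega
    rw [← heq]
    refine (htree X Y T (by rw [hT1])).mono ?_
    rw [hT2]
    have h3 : 1 ≤ ∑ i, p i := by
      calc 1 ≤ ∑ _i : Fin m, 1 := by simpa using hm
        _ ≤ _ := Finset.sum_le_sum fun i _ => hp i
    generalize (∑ i, p i) = w at h3
    have h4 : 1 ≤ k * k * (4 * k * 4 ^ k * b ^ 2 * w) := Nat.succ_le_of_lt (by positivity)
    have h5 : (4 : ℕ) ^ k = 2 ^ k * 2 ^ k := by rw [← mul_pow]; norm_num
    calc t₀ * (2 * k * (17 * k * (2 ^ k * b * (4 * k * (2 ^ k * b)) * w)) + 1)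
        = t₀ * (34 * (k * k * (4 * k * 4 ^ k * b ^ 2 * w)) + 1) := by rw [h5]; ring
      _ ≤ t₀ * (34 * (k * k * (4 * k * 4 ^ k * b ^ 2 * w)) +
            k * k * (4 * k * 4 ^ k * b ^ 2 * w)) := Nat.mul_le_mul_left _ (by omega)
      _ = B * b ^ 2 * w := by simp only [B]; ring

/-! ### Formulae with gates of arbitrary fan-in -/

theorem eval_and_succ {m : ℕ} (v : Fin (m + 2) → Bool) :
    GateKind.and.eval v = (v 0 && GateKind.and.eval fun i => v i.succ) := by
  simp [GateKind.eval, Fin.forall_fin_succ]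

theorem eval_or_succ {m : ℕ} (v : Fin (m + 2) → Bool) :
    GateKind.or.eval v = (v 0 || GateKind.or.eval fun i => v i.succ) := by
  simp [GateKind.eval, Fin.exists_fin_succ]

theorem eval_xor_succ {m : ℕ} (v : Fin (m + 2) → Bool) :
    GateKind.xor.eval v = (v 0 ^^ GateKind.xor.eval fun i => v i.succ) := by
  have h : (Finset.univ.filter fun i => v i = true).card =
      (if v 0 = true then 1 else 0) + (Finset.univ.filter fun i => v (Fin.succ i) = true).card := by
    simp only [Finset.card_filter]
    rw [Fin.sum_univ_succ]
  simp only [GateKind.eval, h]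
  cases v 0
  · simp
  · simp [← Nat.not_even_iff_odd, Nat.even_add_one, add_comm 1]

/-- Gates other than Majority are trees of binary gates. -/
theorem exists_tree_of_gate {X Y : Type} {k : GateKind} (hk : k ≠ .maj) (m : ℕ) :
    ∀ T : Fin (m + 1) → BTree X Y, ∃ T' : BTree X Y, T'.size = ∑ i, (T i).size ∧
      T'.weight = ∑ i, (T i).weight ∧ ∀ x y, T'.eval x y = k.eval fun i => (T i).eval x y := by
  induction m with
  | zero =>
    intro T
    refine ⟨T 0, by simp, by simp, fun x y => ?_⟩
    cases k with
    | maj => exact absurd rfl hk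
    | and => simp [GateKind.eval]
    | or => simp [GateKind.eval]
    | xor => cases h : (T 0).eval x y <;> simp [GateKind.eval, Finset.filter_singleton, h]
  | succ m ih =>
    intro T
    obtain ⟨T', h1, h2, h3⟩ := ih fun i => T i.succ
    cases k with
    | maj => exact absurd rfl hk
    | and =>
      exact ⟨.node .and (T 0) T', by rw [BTree.size, h1, Fin.sum_univ_succ (n := m + 1)],
        by rw [BTree.weight, h2, Fin.sum_univ_succ (n := m + 1)],
        fun x y => by rw [eval_and_succ, ← h3]; rfl⟩
    | or =>
      exact ⟨.node .or (T 0) T', by rw [BTree.size, h1, Fin.sum_univ_succ (n := m + 1)],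
        by rw [BTree.weight, h2, Fin.sum_univ_succ (n := m + 1)],
        fun x y => by rw [eval_or_succ, ← h3]; rfl⟩
    | xor =>
      exact ⟨.node .xor (T 0) T', by rw [BTree.size, h1, Fin.sum_univ_succ (n := m + 1)],
        by rw [BTree.weight, h2, Fin.sum_univ_succ (n := m + 1)],
        fun x y => by rw [eval_xor_succ, ← h3]; rfl⟩

theorem one_le_size {n : ℕ} (F : GateFormula n) : 1 ≤ F.size := by
  induction F with
  | var => simp [GateFormula.size]
  | negVar => simp [GateFormula.size]
  | const => simp [GateFormula.size]
  | gate k m child ih =>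
    rw [GateFormula.size, Fin.sum_univ_succ]
    have := ih 0
    omega

section Formula

variable {n : ℕ} (A : Finset (Fin n))

theorem gHle_var (b : Bool → Bool) (i : Fin n) : GHle (splitInput (fun z => b (z i)) A) 2 := by
  by_cases h : i ∈ A
  · have e : splitInput (fun z => b (z i)) A = fun x _ => b (x ⟨i, h⟩) := by
      funext x y; simp [splitInput, h]
    rw [e]
    exact (GHle.of_alice fun x : {i // i ∈ A} → Bool => b (x ⟨i, h⟩)).mono one_le_two
  · have e : splitInput (fun z => b (z i)) A = fun _ y => b (y ⟨i, h⟩) := by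
      funext x y; simp [splitInput, h]
    rw [e]
    exact GHle.of_bob fun y : {i // i ∉ A} → Bool => b (y ⟨i, h⟩)

/-- A formula is a binary formula over literals and its topmost Majority gates. -/
theorem exists_tree_of_formula {c s D : ℕ} (hD : 1 ≤ D)
    (hmaj : ∀ (m : ℕ) (child : Fin (m + 1) → GateFormula n),
      (GateFormula.gate .maj m child).majDepth ≤ c →
      (GateFormula.gate .maj m child).size ≤ s →
      GHle (splitInput (fun z => (GateFormula.gate .maj m child).eval z) A)
        (2 * D * (GateFormula.gate .maj m child).size)) (F : GateFormula n) :
    F.majDepth ≤ c → F.size ≤ s → ∃ T : BTree ({i // i ∈ A} → Bool) ({i // i ∉ A} → Bool),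
      T.eval = splitInput (fun z => F.eval z) A ∧ T.size ≤ F.size ∧
      T.weight ≤ 2 * D * F.size := by
  have literal : ∀ f, GHle (splitInput f A) 2 →
      ∃ T : BTree ({i // i ∈ A} → Bool) ({i // i ∉ A} → Bool), T.eval = splitInput f A ∧
        T.size ≤ 1 ∧ T.weight ≤ 2 * D * 1 := fun f hf =>
    ⟨.leaf _ 2 hf one_le_two, rfl, le_rfl, by rw [BTree.weight]; omega⟩
  induction F with
  | var i => exact fun _ _ => literal _ (gHle_var A id i)
  | negVar i => exact fun _ _ => literal _ (gHle_var A (fun b => !b) i)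
  | const b => exact fun _ _ => literal _ ((GHle.of_alice fun _ => b).mono one_le_two)
  | gate k m child ih =>
    intro hF hs
    by_cases hk : k = .maj
    · subst hk
      have h1 := one_le_size (.gate .maj m child)
      exact ⟨.leaf _ _ (hmaj m child hF hs) (Nat.succ_le_of_lt (by positivity)), rfl, h1, le_rfl⟩
    · have hdepth : ∀ i, (child i).majDepth ≤ c := fun i => by
        rw [GateFormula.majDepth, if_neg hk, zero_add] at hF
        exact (Finset.le_sup (f := fun i => (child i).majDepth) (Finset.mem_univ i)).trans hF
      have hsize : ∀ i, (child i).size ≤ s := fun i => by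
        rw [GateFormula.size] at hs
        exact (Finset.single_le_sum (f := fun i => (child i).size) (fun _ _ => Nat.zero_le _)
          (Finset.mem_univ i)).trans hs
      choose T h1 h2 h3 using fun i => ih i (hdepth i) (hsize i)
      obtain ⟨T', k1, k2, k3⟩ := exists_tree_of_gate hk m T
      refine ⟨T', ?_, ?_, ?_⟩
      · funext x y
        rw [k3]
        simp only [h1]
        rfl
      · rw [k1, GateFormula.size]
        exact Finset.sum_le_sum fun i _ => h2 i
      · rw [k2, GateFormula.size, Finset.mul_sum]
        exact Finset.sum_le_sum fun i _ => h3 i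

/-- Formulae with at most `c` nested Majority gates. -/
theorem gHle_of_majDepth_le {s tT tM : ℕ} (hT1 : 1 ≤ tT) (hM1 : 1 ≤ tM)
    (hT : ∀ (X Y : Type) (T : BTree X Y), T.size ≤ s → GHle T.eval (tT * T.weight))
    (hM : ∀ (X Y : Type) (m : ℕ) (f : Fin m → X → Y → Bool) (p : Fin m → ℕ),
      1 ≤ m → m ≤ s → (∀ i, GHle (f i) (p i)) → (∀ i, 1 ≤ p i) →
      GHle (fun x y => decide (m ≤ 2 * count f x y)) (tM * ∑ i, p i)) (c : ℕ) :
    ∀ F : GateFormula n, F.majDepth ≤ c → F.size ≤ s →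
      GHle (splitInput (fun z => F.eval z) A) (2 * (tT * tM) ^ c * tT * F.size) := by
  have main : ∀ c D : ℕ, 1 ≤ D → (∀ (m : ℕ) (child : Fin (m + 1) → GateFormula n),
      (GateFormula.gate .maj m child).majDepth ≤ c →
      (GateFormula.gate .maj m child).size ≤ s →
      GHle (splitInput (fun z => (GateFormula.gate .maj m child).eval z) A)
        (2 * D * (GateFormula.gate .maj m child).size)) →
      ∀ F : GateFormula n, F.majDepth ≤ c → F.size ≤ s →
        GHle (splitInput (fun z => F.eval z) A) (2 * D * tT * F.size) := by
    intro c D hD hmaj F hF hs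
    obtain ⟨T, h1, h2, h3⟩ := exists_tree_of_formula A hD hmaj F hF hs
    rw [← h1]
    refine (hT _ _ T (h2.trans hs)).mono ((Nat.mul_le_mul_left tT h3).trans (le_of_eq (by ring)))
  induction c with
  | zero =>
    have := main 0 1 le_rfl fun m child h => by
      rw [GateFormula.majDepth, if_pos rfl] at h
      omega
    simpa using this
  | succ c ih =>
    have hpos : 1 ≤ (tT * tM) ^ (c + 1) := Nat.succ_le_of_lt (by positivity)
    -- A topmost Majority gate uses up one level: its inputs have depth at most `c`, and the gate
    -- itself adds the factor `tM`.
    refine main (c + 1) ((tT * tM) ^ (c + 1)) hpos fun m child hF hs => ?_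
    rw [GateFormula.majDepth, if_pos rfl] at hF
    rw [GateFormula.size] at hs ⊢
    have hchild : ∀ i, GHle (splitInput (fun z => (child i).eval z) A)
        (2 * (tT * tM) ^ c * tT * (child i).size) := fun i => by
      refine ih (child i) ?_ ?_
      · have := Finset.le_sup (f := fun i => (child i).majDepth) (Finset.mem_univ i)
        omega
      · exact (Finset.single_le_sum (f := fun i => (child i).size) (fun _ _ => Nat.zero_le _)
          (Finset.mem_univ i)).trans hs
    have hms : m + 1 ≤ s := by
      refine le_trans ?_ hs
      calc m + 1 = ∑ _i : Fin (m + 1), 1 := by simp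
        _ ≤ _ := Finset.sum_le_sum fun i _ => one_le_size (child i)
    have := hM _ _ (m + 1) _ _ (by omega) hms hchild fun i => by
      have := one_le_size (child i)
      exact Nat.succ_le_of_lt (by positivity)
    refine GHle.mono this (le_of_eq ?_)
    rw [← Finset.mul_sum]
    ring

end Formula

end GardenHose

/-! ### ### The choice of `h` and the final exponent -/

open GardenHose in
theorem mainTheorem7 (c : ℕ) (ε : ℝ) (hε : 0 < ε) :
    ∃ C : ℝ, ∀ (n : ℕ) (A : Finset (Fin n)) (g : (Fin n → Bool) → Bool) (F : GateFormula n),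
      F.Computes g → F.majDepth ≤ c →
        ∃ m : ℕ, gardenHoseComplexity (splitInput g A) = (m : ℕ∞) ∧
          (m : ℝ) ≤ C * (F.size : ℝ) ^ (1 + ε) := by
  -- The overhead consists of `c + 1` factors `tT * tM`, each of order `s ^ (2 / h)`; this `h` keeps
  -- the exponent `2 * (c + 1) / h` below or equal to `ε`.
  obtain ⟨h, hh⟩ := exists_nat_ge ((2 * (c + 1) : ℕ) / ε)
  have hh1 : 1 ≤ h := by
    by_contra h0
    have h0 : h = 0 := by omega
    subst h0
    have : 0 < ((2 * (c + 1) : ℕ) : ℝ) / ε := by positivity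
    rw [Nat.cast_zero] at hh
    linarith
  obtain ⟨C₁, h₁⟩ := exists_treeFactor h hh1
  obtain ⟨C₂, h₂⟩ := exists_majorityFactor h hh1
  let K : ℕ := 2 ^ h * (C₁ * C₂) ^ (c + 1)
  refine ⟨(K : ℝ) ^ ((1 : ℝ) / h), fun n A g F hF hc => ?_⟩
  obtain rfl : (fun z => F.eval z) = g := funext hF
  have hs := one_le_size F
  obtain ⟨tT, hT1, hT2, hT3⟩ := h₁ F.size hs
  obtain ⟨tM, hM1, hM2, hM3⟩ := h₂ F.size hs
  obtain ⟨m, hm, hle⟩ := exists_gardenHoseComplexity_eq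
    (gHle_of_majDepth_le A hT1 hM1 hT3 hM3 c F hc le_rfl)
  refine ⟨m, hm, ?_⟩
  let B := 2 * (tT * tM) ^ (c + 1)
  have hB : B ^ h ≤ K * F.size ^ (2 * (c + 1)) := by
    calc B ^ h = 2 ^ h * (tT ^ h * tM ^ h) ^ (c + 1) := by
          simp only [B]
          rw [mul_pow, ← mul_pow tT, ← pow_mul, ← pow_mul, mul_comm h]
      _ ≤ 2 ^ h * ((C₁ * F.size) * (C₂ * F.size)) ^ (c + 1) :=
          Nat.mul_le_mul_left _ (Nat.pow_le_pow_left (Nat.mul_le_mul hT2 hM2) _)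
      _ = _ := by simp only [K]; ring
  have hmB : m ≤ B * F.size := by
    refine hle.trans (Nat.mul_le_mul_right _ ?_)
    calc 2 * (tT * tM) ^ c * tT = 2 * (tT * tM) ^ c * (tT * 1) := by ring
      _ ≤ 2 * (tT * tM) ^ c * (tT * tM) :=
          Nat.mul_le_mul_left _ (Nat.mul_le_mul_left _ hM1)
      _ = B := by simp only [B]; ring
  have hs' : (1 : ℝ) ≤ F.size := by exact_mod_cast hs
  have hh0 : (0 : ℝ) < h := by exact_mod_cast hh1
  have hBR : (B : ℝ) ≤ (K : ℝ) ^ ((1 : ℝ) / h) * (F.size : ℝ) ^ ε := by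
    have h1 : (B : ℝ) ^ (h : ℝ) ≤ K * (F.size : ℝ) ^ (2 * (c + 1)) := by
      rw [Real.rpow_natCast]; exact_mod_cast hB
    calc (B : ℝ) = ((B : ℝ) ^ (h : ℝ)) ^ ((1 : ℝ) / h) := by
          rw [← Real.rpow_mul (Nat.cast_nonneg _), mul_one_div_cancel hh0.ne', Real.rpow_one]
      _ ≤ (K * (F.size : ℝ) ^ (2 * (c + 1))) ^ ((1 : ℝ) / h) :=
          Real.rpow_le_rpow (by positivity) h1 (by positivity)
      _ = (K : ℝ) ^ ((1 : ℝ) / h) * (F.size : ℝ) ^ (((2 * (c + 1) : ℕ) : ℝ) * (1 / h)) := by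
          rw [Real.mul_rpow (by positivity) (by positivity), ← Real.rpow_natCast (F.size : ℝ),
            ← Real.rpow_mul (by positivity)]
      _ ≤ _ := by
          refine mul_le_mul_of_nonneg_left (Real.rpow_le_rpow_of_exponent_le hs' ?_)
            (by positivity)
          rw [mul_one_div, div_le_iff₀ hh0]
          rw [div_le_iff₀ hε] at hh
          linarith
  calc (m : ℝ) ≤ B * F.size := by exact_mod_cast hmB
    _ ≤ (K : ℝ) ^ ((1 : ℝ) / h) * (F.size : ℝ) ^ ε * F.size :=
        mul_le_mul_of_nonneg_right hBR (by positivity)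
    _ = _ := by rw [Real.rpow_add (by linarith), Real.rpow_one]; ring
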